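/- Let $\Omega=\{0,1\}^{\mathbb Z}$, $(\tau_x\eta)(y)=\eta(x+y)$, and let $\eta^{x,x+1}$ be $\eta$ with the values at $x$ and $x+1$ interchanged. A function on $\Omega$ is local if it depends on finitely many coordinates only. Let $\rho\in(0,1)$ and let $\nu_\rho$ be the Bernoulli product measure of density $\rho$ on $\Omega$. Let $\mathcal R\subseteq\mathbb Z\setminus\{0\}$ be a finite set, let $r_z:\Omega\to[0,\infty)$ be a local function for each $z\in\mathcal R$, and let $\epsilon_0>0$. Then there is a constant $C$, depending only on $\rho$, $\{r_z\}_{z\in\mathcal R}$ and $\epsilon_0$, with the following property. Let $c:\Omega\to[0,\infty)$ be a local function with $c\ge\epsilon_0$ everywhere and such that $c(\eta)$ does not depend on $\eta(0),\eta(1)$, and let $n\ge1$ be an integer. Let $(\eta^n_t,x^n_t)_{t\ge0}$ be a càdlàg Markov process on $\Omega\times\mathbb Z$ such that $\eta^n_0$ has law $\nu_\rho$, $x^n_0=0$ almost surely, and which is generated by $$L_nf(\eta,x)=n^2\sum_{y\in\mathbb Z}c(\tau_y\eta)\,[f(\eta^{y,y+1},x)-f(\eta,x)]+n\sum_{z\in\mathcal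 R}r_z(\tau_x\eta)\,[f(\eta,x+z)-f(\eta,x)],$$ in the sense that, with respect to some filtration to which the process is adapted, $f(\eta^n_t,x^n_t)-\int_0^tL_nf(\eta^n_s,x^n_s)\,ds$ is a martingale for every $f:\Omega\times\mathbb Z\to\mathbb R$ that depends on finitely many coordinates of $\eta$ only and vanishes for $x$ outside a finite set. Let $\xi^n_t(y)=\eta^n_t(y+x^n_t)$ be the environment seen by the walker, let $\mu^n_t$ be its law at time $t$, and let $$H_n(t)=H(\mu^n_t\,|\,\nu_\rho)=\int f_t\log f_t\,d\nu_\rho,\qquad f_t=\frac{d\mu^n_t}{d\nu_\rho},$$ be its relative entropy with respect to $\nu_\rho$. Then $H_n(t)<\infty$ for every $t\ge0$, the function $H_n$ is differentiable on $[0,\infty)$ (from the right at $0$), and $$H_n'(t)\le C\quad\text{for all }t\ge0,\qquad\text{hence}\qquad H_n(t)\le Ct\quad\text{for all }t\ge0 .$$ In particular $C$ depends neither on $n$, nor on $t$, nor on $c$ except through $\epsilon_0$. -/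

import Mathlib

open MeasureTheory ProbabilityTheory InformationTheory
open scoped NNReal Topology

noncomputable section

namespace ExclusionRW

/-- Configurations `η ∈ Ω = {0,1}^ℤ`: `η x = true` means that the site `x` is occupied. The space
carries the product topology and the product σ-algebra. -/
abbrev Config : Type := ℤ → Bool

/-- The shift `τ_x`, `(τ_x η)(y) = η (x + y)`. -/
def shift (x : ℤ) (η : Config) : Config := fun y => η (x + y)

/-- The configuration `η^{x,x+1}`, with the values at `x` and `x + 1` interchanged. -/
def exchange (x : ℤ) (η : Config) : Config := fun z => η (Equiv.swap x (x + 1) z)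

/-- A function of the configuration is local if it depends on finitely many sites only. -/
def IsLocal (f : Config → ℝ) : Prop := ∃ A : Finset ℤ, DependsOn f (A : Set ℤ)

/-- The Bernoulli product measure `ν_ρ` of density `ρ` on `{0,1}^ℤ`. -/
def bernoulliProduct (ρ : unitInterval) : Measure Config :=
  Measure.infinitePi fun _ : ℤ => bernoulliMeasure true false ρ

/-- The conditions on the interaction rate `c` of the lattice gas: finite range, ellipticity with
constant `ε₀`, and reversibility. -/
structure IsInteractionRate (ε₀ : ℝ) (c : Config → ℝ) : Prop where
  finite_range : IsLocal c
  elliptic : ∀ η, ε₀ ≤ c η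
  reversible : DependsOn c ({0, 1}ᶜ : Set ℤ)

/-- The test functions on `Ω × ℤ`: functions `f (η, x)` that vanish unless `x` is in a finite set
and that depend on finitely many coordinates of `η` only. -/
def IsTestFunction (f : Config → ℤ → ℝ) : Prop :=
  (∃ A : Finset ℤ, ∀ x, DependsOn (fun η => f η x) (A : Set ℤ)) ∧
    ∃ B : Finset ℤ, ∀ η, ∀ x ∉ B, f η x = 0

/-- The generator of the pair (lattice gas speeded up by `n ^ 2`, walker),
`L_n f (η, x) = n² ∑_y c_y(η) [f(η^{y,y+1}, x) - f(η, x)]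
  + n ∑_{z ∈ R} r_z(τ_x η) [f(η, x + z) - f(η, x)]`.
For `f` a test function only finitely many terms of the sum over `y` are nonzero. -/
def generator (c : Config → ℝ) {R : Finset ℤ} (r : R → Config → ℝ) (n : ℕ)
    (f : Config → ℤ → ℝ) (η : Config) (x : ℤ) : ℝ :=
  (n : ℝ) ^ 2 * ∑' y : ℤ, c (shift y η) * (f (exchange y η) x - f η x)
    + (n : ℝ) * ∑ z : R, r z (shift x η) * (f η (x + z) - f η x)

/-- Right-continuity with left limits, for paths indexed by `[0, ∞)`. -/
def IsCadlag {E : Type*} [TopologicalSpace E] (y : ℝ≥0 → E) : Prop :=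
  ∀ t, ContinuousWithinAt y (Set.Ici t) t ∧ ∃ l, Filter.Tendsto y (𝓝[<] t) (𝓝 l)

/-- `(η, x)` is a Markov process with càdlàg paths on `Ω × ℤ` generated by `L_n`, in the sense of
the martingale problem, with `η 0` distributed according to `ν_ρ` and `x 0 = 0`: the walk `x` in
the dynamic random environment `η`. -/
structure IsWalkInExclusion (ρ : unitInterval) (c : Config → ℝ) {R : Finset ℤ}
    (r : R → Config → ℝ) (n : ℕ) {S : Type*} [MeasurableSpace S] (P : Measure S)
    (𝓕 : Filtration ℝ≥0 ‹MeasurableSpace S›) (η : ℝ≥0 → S → Config) (x : ℝ≥0 → S → ℤ) :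
    Prop where
  adapted_env : Adapted 𝓕 η
  adapted_walk : Adapted 𝓕 x
  cadlag_env : ∀ ω, IsCadlag fun t => η t ω
  cadlag_walk : ∀ ω, IsCadlag fun t => x t ω
  initial_env : P.map (η 0) = bernoulliProduct ρ
  initial_walk : ∀ᵐ ω ∂P, x 0 ω = 0
  martingale : ∀ f : Config → ℤ → ℝ, IsTestFunction f →
    Martingale (fun (t : ℝ≥0) ω => f (η t ω) (x t ω)
      - ∫ s in (0 : ℝ)..t, generator c r n f (η s.toNNReal ω) (x s.toNNReal ω)) 𝓕 P

/-- The environment as seen by the walker, `ξ_t(y) = η_t(y + x_t)`. -/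
def envSeen {S : Type*} (η : ℝ≥0 → S → Config) (x : ℝ≥0 → S → ℤ) (t : ℝ≥0) (ω : S) : Config :=
  fun y => η t ω (y + x t ω)

/-- The relative entropy of the law of `ξ_t` with respect to `ν_ρ`, in `[0, ∞]`. -/
def envEntropy (ρ : unitInterval) {S : Type*} [MeasurableSpace S] (P : Measure S)
    (η : ℝ≥0 → S → Config) (x : ℝ≥0 → S → ℤ) (t : ℝ≥0) : ENNReal :=
  klDiv (P.map (envSeen η x t)) (bernoulliProduct ρ)

end ExclusionRW

end

/-!
The law `μ_t` of the environment seen by the walker solves, tested against local functions, the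
forward equation of the operator `n² L_exc + n L_jump`, where `L_exc` performs the exchanges and
`L_jump g (ξ) = ∑ z, r_z(ξ) (g (τ_z ξ) - g ξ)`. The entropy bound comes from the balance of the two
parts along the flow of the density `f_t` of `μ_t`.

*The bound.* As `c` does not depend on the two sites of the bond, the exchanges are reversible for
the Bernoulli measure `ν`, and they contribute at most `-(n² ε₀ / 2) ∑ y, D_y` to the derivative of
the entropy, where `D_y = ∫ (f^{y,y+1} - f) (log f^{y,y+1} - log f) dν`. The jumps contribute at
most `n ∑ z, ∫ (r_z ∘ τ_{-z} - r_z) f dν`, by `a (log b - log a) ≤ b - a`. Since `r_z` is local, the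
shift can be replaced by finitely many exchanges (`exists_exchList_eq_trans`), so that the integral
is at most `‖r_z‖ ∑ y, ∫ |f^{y,y+1} - f| dν` over finitely many bonds (`mean_exchList_sub_le`). By
`|b - a| ≤ (θ / 2) (b - a) (log b - log a) + (a + b) / (2 θ)` with `θ` of order `n`, the terms `D_y`
are absorbed into the dissipation of the exchanges, and what is left is of order `n / θ`, thus
bounded (`exists_mean_log_mul_boxOp_le`).

*The density.* The bound has to be applied to the process on the whole line. The dynamics with the
exchanges restricted to the box `[-N, N]` is generated by a bounded operator on the continuous
functions on `{0,1}^ℤ`, and its semigroup is an exponential. The norm `oscNorm`, the supremum norm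
plus the sum of the oscillations `sup |u (flip x) - u|` weighted by `1 + |x|`, grows under these
semigroups at a rate that does not depend on the box (`oscNorm_boxSemigroup_le`), while the
generators of two boxes differ by `O(oscNorm u / N)` (`norm_boxOp_sub_le`). Hence the semigroups of
growing boxes converge, the limiting evolution of a constant function is differentiable in time up
to time `0` (`exists_limit_hasDerivWithinAt`), and any solution of the forward equation is given by
the limit (`SolvesForward.tendsto_mean`). This applies to the environment seen by the walker and
also to the adjoint dynamics, in which the jumps are replaced by their adjoint with respect to `ν`.
The adjoint evolution of the constant function `1` is therefore the density of `μ_t`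
(`exists_density`). It is continuous on the compact space of configurations, it is differentiable in
time with respect to the supremum norm, and it is bounded from below by `exp (-κ t)`, where `κ` is
`n ∑ z, ‖r_z‖`. So the entropy is finite, the chain rule applies to `∫ f_t log f_t dν`, and the
derivative is the limit of the entropy productions in the boxes (`entropy_of_solvesForward`).
-/

open scoped ENNReal

noncomputable section

namespace ExclusionRW

/-! ### Observables and their operators -/

/-- Observables: the continuous functions on the compact space of configurations, with the
supremum norm. A definition rather than an abbreviation, so that the instances needed here are found
without a search through those of `C(Config, ℝ)`. -/
def Obs : Type := C(Config, ℝ)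

namespace Obs

instance : NormedCommRing Obs := inferInstanceAs (NormedCommRing C(Config, ℝ))

instance : NormedAlgebra ℝ Obs := inferInstanceAs (NormedAlgebra ℝ C(Config, ℝ))

instance : CompleteSpace Obs := inferInstanceAs (CompleteSpace C(Config, ℝ))

instance : FunLike Obs Config ℝ := inferInstanceAs (FunLike C(Config, ℝ) Config ℝ)

/-- The observable given by a continuous function. -/
def mk (f : Config → ℝ) (hf : Continuous f) : Obs := (⟨f, hf⟩ : C(Config, ℝ))

lemma continuous (u : Obs) : Continuous u := ContinuousMap.continuous (show C(Config, ℝ) from u)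

lemma ext {u v : Obs} (h : ∀ η, u η = v η) : u = v := DFunLike.ext _ _ h

@[simp] lemma add_apply (u v : Obs) (η : Config) : (u + v) η = u η + v η := rfl

@[simp] lemma sub_apply (u v : Obs) (η : Config) : (u - v) η = u η - v η := rfl

@[simp] lemma neg_apply (u : Obs) (η : Config) : (-u) η = -u η := rfl

@[simp] lemma mul_apply (u v : Obs) (η : Config) : (u * v) η = u η * v η := rfl

@[simp] lemma smul_apply (a : ℝ) (u : Obs) (η : Config) : (a • u) η = a * u η := rfl

@[simp] lemma zero_apply (η : Config) : (0 : Obs) η = 0 := rfl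

@[simp] lemma one_apply (η : Config) : (1 : Obs) η = 1 := rfl

/-- Evaluation at a configuration. -/
def evalHom (η : Config) : Obs →+ ℝ where
  toFun u := u η
  map_zero' := rfl
  map_add' _ _ := rfl

@[simp] lemma sum_apply {ι : Type*} (s : Finset ι) (u : ι → Obs) (η : Config) :
    (∑ i ∈ s, u i) η = ∑ i ∈ s, u i η :=
  map_sum (evalHom η) u s

lemma norm_le {u : Obs} {C : ℝ} (hC : 0 ≤ C) : ‖u‖ ≤ C ↔ ∀ η, |u η| ≤ C :=
  ContinuousMap.norm_le (show C(Config, ℝ) from u) hC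

lemma abs_le_norm (u : Obs) (η : Config) : |u η| ≤ ‖u‖ :=
  ContinuousMap.norm_coe_le_norm (show C(Config, ℝ) from u) η

lemma apply_le_norm (u : Obs) (η : Config) : u η ≤ ‖u‖ := (le_abs_self _).trans (abs_le_norm u η)

lemma abs_sub_le_two_norm (u : Obs) (η ζ : Config) : |u η - u ζ| ≤ 2 * ‖u‖ :=
  (abs_sub _ _).trans (by linarith [abs_le_norm u η, abs_le_norm u ζ])

end Obs

/-- Composition with a continuous map, as a bounded operator on observables. -/
def compOp (φ : C(Config, Config)) : Obs →L[ℝ] Obs :=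
  LinearMap.mkContinuous
    { toFun := fun u => Obs.mk (fun η => u (φ η)) (u.continuous.comp φ.continuous)
      map_add' := fun _ _ => rfl
      map_smul' := fun _ _ => rfl } 1 fun u => by
    rw [one_mul]
    exact (Obs.norm_le (norm_nonneg _)).2 fun η => u.abs_le_norm _

@[simp] lemma compOp_apply (φ : C(Config, Config)) (u : Obs) (η : Config) :
    compOp φ u η = u (φ η) := rfl

/-- Multiplication by an observable. -/
def mulOp (a : Obs) : Obs →L[ℝ] Obs := ContinuousLinearMap.mul ℝ Obs a

@[simp] lemma mulOp_apply (a u : Obs) (η : Config) : mulOp a u η = a η * u η := rfl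

lemma norm_compOp_le (φ : C(Config, Config)) (u : Obs) : ‖compOp φ u‖ ≤ ‖u‖ :=
  (Obs.norm_le (norm_nonneg _)).2 fun _ => u.abs_le_norm _

/-- A permutation of the sites acting on configurations. -/
def permute (σ : Equiv.Perm ℤ) : C(Config, Config) where
  toFun η := fun x => η (σ x)
  continuous_toFun := by fun_prop

/-- The exchange across the bond `{y, y + 1}`, as a continuous map. -/
def exch (y : ℤ) : C(Config, Config) := permute (Equiv.swap y (y + 1))

/-- The shift by `x`, as a continuous map. -/
def trans (x : ℤ) : C(Config, Config) := permute (Equiv.addLeft x)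

lemma exch_apply (y : ℤ) (η : Config) : exch y η = exchange y η := rfl

/-- The flip of the value at the site `x`. -/
def flip (x : ℤ) : C(Config, Config) where
  toFun η := Function.update η x (!η x)
  continuous_toFun := by
    refine continuous_id.update x ?_
    exact (continuous_of_discreteTopology (f := not)).comp (continuous_apply x)

lemma flip_apply (x : ℤ) (η : Config) (y : ℤ) : flip x η y = if y = x then !η x else η y := by
  simp [flip, Function.update_apply]

lemma permute_flip (σ : Equiv.Perm ℤ) (x : ℤ) (η : Config) :
    permute σ (flip x η) = flip (σ.symm x) (permute σ η) := by
  ext y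
  change flip x η (σ y) = _
  rw [flip_apply, flip_apply]
  change _ = if y = σ.symm x then !η (σ (σ.symm x)) else η (σ y)
  simp [Equiv.eq_symm_apply]

lemma exch_exch (y : ℤ) (η : Config) : exch y (exch y η) = η := by
  funext z
  change η (Equiv.swap y (y + 1) (Equiv.swap y (y + 1) z)) = η z
  simp

lemma exch_flip (y x : ℤ) (η : Config) :
    exch y (flip x η) = flip (Equiv.swap y (y + 1) x) (exch y η) := by
  rw [exch, permute_flip, Equiv.symm_swap]

lemma trans_flip (z x : ℤ) (η : Config) : trans z (flip x η) = flip (x - z) (trans z η) := by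
  rw [trans, permute_flip]
  congr 2
  change -z + x = x - z
  ring

lemma trans_trans (x y : ℤ) (η : Config) : trans x (trans y η) = trans (x + y) η := by
  funext z
  change η (y + (x + z)) = η ((x + y) + z)
  congr 1; ring

lemma trans_zero (η : Config) : trans 0 η = η := by
  funext z
  change η (0 + z) = η z
  simp

lemma trans_exch (x y : ℤ) (η : Config) : trans x (exch y η) = exch (y - x) (trans x η) := by
  funext z
  change η (Equiv.swap y (y + 1) (x + z)) = η (x + Equiv.swap (y - x) (y - x + 1) z)
  congr 1
  simp only [Equiv.swap_apply_def]
  split_ifs <;> omega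

/-- An exchange either does nothing or flips the two sites of the bond. -/
lemma exch_eq_flip_flip (y : ℤ) (η : Config) :
    exch y η = η ∨ exch y η = flip y (flip (y + 1) η) := by
  by_cases h : η y = η (y + 1)
  · left
    funext z
    change η (Equiv.swap y (y + 1) z) = η z
    simp only [Equiv.swap_apply_def]
    split_ifs with h1 h2
    · rw [h1, h]
    · rw [h2, h]
    · rfl
  · right
    have h' : η (y + 1) = !η y := by
      cases h1 : η y <;> cases h2 : η (y + 1) <;> simp_all
    funext z
    rw [flip_apply, flip_apply, flip_apply]
    change η (Equiv.swap y (y + 1) z) = _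
    simp only [Equiv.swap_apply_def]
    have h0 : η y = !η (y + 1) := by rw [h', Bool.not_not]
    split_ifs <;> first | omega | exact h' | exact h0 | rfl

/-! ### Local observables -/

lemma IsLocal.continuous {f : Config → ℝ} (hf : IsLocal f) : Continuous f := by
  obtain ⟨A, hA⟩ := hf
  obtain ⟨g, rfl⟩ := dependsOn_iff_exists_comp.1 hA
  refine Continuous.comp ?_ (by
    refine continuous_pi fun i => continuous_apply _)
  exact continuous_of_discreteTopology

lemma dependsOn_flip {f : Config → ℝ} {A : Set ℤ} (hf : DependsOn f A) {x : ℤ} (hx : x ∉ A)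
    (η : Config) : f (flip x η) = f η := by
  refine hf fun i hi => ?_
  rw [flip_apply, if_neg]
  rintro rfl
  exact hx hi

/-! ### The weighted oscillation norm -/

/-- The weight `1 + |x|` of a site. It is submultiplicative, and it tends to infinity, which makes
the oscillations at distant sites of an observable of finite `oscNorm` small. -/
def weight (x : ℤ) : ℝ≥0∞ := ((x.natAbs + 1 : ℕ) : ℝ≥0∞)

lemma one_le_weight (x : ℤ) : 1 ≤ weight x := by
  unfold weight
  exact_mod_cast Nat.le_add_left 1 _

lemma weight_ne_top (x : ℤ) : weight x ≠ ⊤ := ENNReal.natCast_ne_top _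

lemma weight_add_le (x y : ℤ) : weight (x + y) ≤ weight x * weight y := by
  unfold weight
  have := Int.natAbs_add_le x y
  have h : (x + y).natAbs + 1 ≤ (x.natAbs + 1) * (y.natAbs + 1) := by
    have := Nat.zero_le (x.natAbs * y.natAbs)
    have e : (x.natAbs + 1) * (y.natAbs + 1) =
        x.natAbs * y.natAbs + x.natAbs + y.natAbs + 1 := by ring
    omega
  exact_mod_cast h

lemma tsum_weight_shift_le (f : ℤ → ℝ≥0∞) (b : ℤ) :
    ∑' x, weight x * f (x - b) ≤ weight b * ∑' x, weight x * f x := by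
  rw [← (Equiv.addRight b).tsum_eq, ← ENNReal.tsum_mul_left]
  refine ENNReal.tsum_le_tsum fun x => ?_
  simp only [Equiv.coe_addRight, add_sub_cancel_right]
  rw [← mul_assoc]
  gcongr
  rw [mul_comm]
  exact weight_add_le x b

/-- The oscillation of `u` at the site `x`: the largest change of `u` when the value at `x` is
flipped. -/
def osc (x : ℤ) (u : Obs) : ℝ := ‖compOp (flip x) u - u‖

/-- The weighted sum `∑ x, (1 + |x|) osc x u`, possibly infinite. -/
def totalOsc (u : Obs) : ℝ≥0∞ := ∑' x, weight x * ENNReal.ofReal (osc x u)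

/-- The supremum norm plus the weighted sum of the oscillations. It is finite for local observables,
but the dynamics does not keep observables local; it does keep `oscNorm` finite. -/
def oscNorm (u : Obs) : ℝ≥0∞ := ENNReal.ofReal ‖u‖ + totalOsc u

lemma osc_nonneg (x : ℤ) (u : Obs) : 0 ≤ osc x u := norm_nonneg _

lemma abs_flip_sub_le (x : ℤ) (u : Obs) (η : Config) : |u (flip x η) - u η| ≤ osc x u :=
  (compOp (flip x) u - u).abs_le_norm η

lemma osc_le {x : ℤ} {u : Obs} {C : ℝ} (hC : 0 ≤ C) (h : ∀ η, |u (flip x η) - u η| ≤ C) :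
    osc x u ≤ C :=
  (Obs.norm_le hC).2 h

lemma abs_exch_sub_le (y : ℤ) (u : Obs) (η : Config) :
    |u (exch y η) - u η| ≤ osc y u + osc (y + 1) u := by
  rcases exch_eq_flip_flip y η with h | h
  · rw [h, sub_self, abs_zero]
    exact add_nonneg (osc_nonneg _ _) (osc_nonneg _ _)
  · rw [h]
    calc _ ≤ |u (flip y (flip (y + 1) η)) - u (flip (y + 1) η)| + |u (flip (y + 1) η) - u η| :=
          abs_sub_le _ _ _
      _ ≤ _ := add_le_add (abs_flip_sub_le _ _ _) (abs_flip_sub_le _ _ _)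

lemma osc_of_dependsOn {u : Obs} {A : Set ℤ} (hu : DependsOn u A) {x : ℤ} (hx : x ∉ A) :
    osc x u = 0 :=
  le_antisymm (osc_le le_rfl fun η => by rw [dependsOn_flip hu hx]; simp) (osc_nonneg _ _)

lemma totalOsc_le_oscNorm (u : Obs) : totalOsc u ≤ oscNorm u := le_add_self

lemma oscNorm_ne_top_of_isLocal {u : Obs} (hu : IsLocal u) : oscNorm u ≠ ⊤ := by
  obtain ⟨A, hA⟩ := hu
  refine ENNReal.add_ne_top.2 ⟨ENNReal.ofReal_ne_top, ?_⟩
  rw [totalOsc, tsum_eq_sum (s := A)]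
  · refine ENNReal.sum_ne_top.2 fun x _ => ?_
    exact ENNReal.mul_ne_top (weight_ne_top x) ENNReal.ofReal_ne_top
  · intro x hx
    rw [osc_of_dependsOn hA (by simpa using hx)]
    simp

lemma oscNorm_add_le (u v : Obs) : oscNorm (u + v) ≤ oscNorm u + oscNorm v := by
  have h : totalOsc (u + v) ≤ totalOsc u + totalOsc v := by
    rw [totalOsc, totalOsc, totalOsc, ← ENNReal.tsum_add]
    refine ENNReal.tsum_le_tsum fun x => ?_
    rw [← mul_add, ← ENNReal.ofReal_add (osc_nonneg _ _) (osc_nonneg _ _)]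
    gcongr
    unfold osc
    rw [map_add, add_sub_add_comm]
    exact norm_add_le _ _
  calc oscNorm (u + v) ≤ (ENNReal.ofReal ‖u‖ + ENNReal.ofReal ‖v‖) + (totalOsc u + totalOsc v) := by
        refine add_le_add ?_ h
        rw [← ENNReal.ofReal_add (norm_nonneg _) (norm_nonneg _)]
        exact ENNReal.ofReal_le_ofReal (norm_add_le _ _)
    _ = _ := by unfold oscNorm; ring

lemma oscNorm_smul (a : ℝ) (u : Obs) : oscNorm (a • u) = ENNReal.ofReal |a| * oscNorm u := by
  unfold oscNorm totalOsc
  rw [mul_add, ← ENNReal.tsum_mul_left, norm_smul, ENNReal.ofReal_mul (norm_nonneg _),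
    Real.norm_eq_abs]
  congr 2
  funext x
  unfold osc
  rw [map_smul, ← smul_sub, norm_smul, ENNReal.ofReal_mul (norm_nonneg _), Real.norm_eq_abs]
  ring

lemma oscNorm_zero : oscNorm 0 = 0 := by
  simpa using oscNorm_smul 0 0

lemma ofReal_norm_tsum_le {E : Type*} [NormedAddCommGroup E] (u : ℕ → E) :
    ENNReal.ofReal ‖∑' k, u k‖ ≤ ∑' k, ENNReal.ofReal ‖u k‖ := by
  simp only [ofReal_norm]
  exact enorm_tsum_le_tsum_enorm

lemma oscNorm_tsum_le {u : ℕ → Obs} (hu : Summable u) :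
    oscNorm (∑' k, u k) ≤ ∑' k, oscNorm (u k) := by
  unfold oscNorm totalOsc
  rw [ENNReal.tsum_add, ENNReal.tsum_comm]
  refine add_le_add (ofReal_norm_tsum_le u) (ENNReal.tsum_le_tsum fun x => ?_)
  rw [ENNReal.tsum_mul_left]
  gcongr
  unfold osc
  rw [(compOp (flip x)).map_tsum hu, ← ((compOp (flip x)).summable hu).tsum_sub hu]
  exact ofReal_norm_tsum_le _

lemma oscNorm_mulOp_le (a u : Obs) : oscNorm (mulOp a u) ≤ oscNorm a * oscNorm u := by
  have h : totalOsc (mulOp a u) ≤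
      ENNReal.ofReal ‖a‖ * totalOsc u + totalOsc a * ENNReal.ofReal ‖u‖ := by
    unfold totalOsc
    rw [← ENNReal.tsum_mul_left, ← ENNReal.tsum_mul_right, ← ENNReal.tsum_add]
    refine ENNReal.tsum_le_tsum fun x => ?_
    have hx : osc x (mulOp a u) ≤ ‖a‖ * osc x u + osc x a * ‖u‖ := by
      refine osc_le ?_ fun η => ?_
      · have := osc_nonneg x u; have := osc_nonneg x a; positivity
      · have e : mulOp a u (flip x η) - mulOp a u η =
            a (flip x η) * (u (flip x η) - u η) + (a (flip x η) - a η) * u η := by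
          simp only [mulOp_apply]; ring
        rw [e]
        refine (abs_add_le _ _).trans ?_
        rw [abs_mul, abs_mul]
        exact add_le_add (mul_le_mul (a.abs_le_norm _) (abs_flip_sub_le _ _ _)
          (abs_nonneg _) (norm_nonneg _)) (mul_le_mul (abs_flip_sub_le _ _ _)
          (u.abs_le_norm _) (abs_nonneg _) (osc_nonneg _ _))
    calc weight x * ENNReal.ofReal (osc x (mulOp a u))
        ≤ weight x * (ENNReal.ofReal ‖a‖ * ENNReal.ofReal (osc x u) +
            ENNReal.ofReal (osc x a) * ENNReal.ofReal ‖u‖) := by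
          gcongr
          refine (ENNReal.ofReal_le_ofReal hx).trans (le_of_eq ?_)
          have := osc_nonneg x u; have := osc_nonneg x a
          rw [ENNReal.ofReal_add (by positivity) (by positivity),
            ENNReal.ofReal_mul (by positivity), ENNReal.ofReal_mul (by positivity)]
      _ = _ := by ring
  have h1 : ENNReal.ofReal ‖mulOp a u‖ ≤ ENNReal.ofReal ‖a‖ * ENNReal.ofReal ‖u‖ := by
    rw [← ENNReal.ofReal_mul (norm_nonneg _)]
    exact ENNReal.ofReal_le_ofReal (norm_mul_le a u)
  calc oscNorm (mulOp a u)
      ≤ ENNReal.ofReal ‖a‖ * ENNReal.ofReal ‖u‖ + (ENNReal.ofReal ‖a‖ * totalOsc u +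
          totalOsc a * ENNReal.ofReal ‖u‖) := add_le_add h1 h
    _ ≤ ENNReal.ofReal ‖a‖ * ENNReal.ofReal ‖u‖ + (ENNReal.ofReal ‖a‖ * totalOsc u +
          totalOsc a * ENNReal.ofReal ‖u‖) + totalOsc a * totalOsc u :=
        le_self_add
    _ = _ := by unfold oscNorm; ring

lemma osc_trans (x z : ℤ) (u : Obs) : osc x (compOp (trans z) u) ≤ osc (x - z) u := by
  refine osc_le (osc_nonneg _ _) fun η => ?_
  rw [compOp_apply, compOp_apply, trans_flip]
  exact abs_flip_sub_le _ _ _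

lemma oscNorm_trans_le (z : ℤ) (u : Obs) :
    oscNorm (compOp (trans z) u) ≤ weight z * oscNorm u := by
  unfold oscNorm
  rw [mul_add]
  refine add_le_add ?_ ?_
  · calc ENNReal.ofReal ‖compOp (trans z) u‖ ≤ ENNReal.ofReal ‖u‖ :=
          ENNReal.ofReal_le_ofReal (norm_compOp_le _ _)
      _ ≤ _ := le_mul_of_one_le_left zero_le (one_le_weight z)
  · unfold totalOsc
    refine le_trans (ENNReal.tsum_le_tsum fun x => ?_) (tsum_weight_shift_le _ z)
    gcongr
    exact osc_trans x z u

/-! ### The exclusion dynamics in a finite box -/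

/-- The exchanges across the bond `{y, y + 1}`, at rate `c (τ_y η)`. -/
def bondOp (c : Obs) (y : ℤ) : Obs →L[ℝ] Obs :=
  mulOp (compOp (trans y) c) ∘L (compOp (exch y) - 1)

lemma bondOp_apply (c : Obs) (y : ℤ) (u : Obs) (η : Config) :
    bondOp c y u η = c (trans y η) * (u (exch y η) - u η) := rfl

/-- The generator of the exclusion dynamics on the bonds `{y, y + 1}` with `|y| ≤ N`. -/
def exclOp (c : Obs) (N : ℕ) : Obs →L[ℝ] Obs := ∑ y ∈ Finset.Icc (-N : ℤ) N, bondOp c y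

lemma exclOp_apply (c : Obs) (N : ℕ) (u : Obs) (η : Config) :
    exclOp c N u η = ∑ y ∈ Finset.Icc (-N : ℤ) N, c (trans y η) * (u (exch y η) - u η) := by
  simp [exclOp, bondOp_apply, Obs.sum_apply]

/-- A number that dominates the total exchange rate in the box. -/
def boxRate (c : Obs) (N : ℕ) : ℝ := (2 * N + 1) * ‖c‖

lemma boxRate_nonneg (c : Obs) (N : ℕ) : 0 ≤ boxRate c N := by unfold boxRate; positivity

lemma sum_rate_le (c : Obs) (N : ℕ) (η : Config) :
    ∑ y ∈ Finset.Icc (-N : ℤ) N, c (trans y η) ≤ boxRate c N := by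
  calc _ ≤ ∑ y ∈ Finset.Icc (-N : ℤ) N, ‖c‖ :=
        Finset.sum_le_sum fun y _ => c.apply_le_norm _
    _ = boxRate c N := by
        rw [Finset.sum_const, Int.card_Icc, boxRate, nsmul_eq_mul]
        congr 1
        have : ((N : ℤ) + 1 - -N).toNat = 2 * N + 1 := by omega
        rw [this]; push_cast; ring

lemma exclOp_add_apply (c : Obs) (N : ℕ) (K : ℝ) (u : Obs) (η : Config) :
    (exclOp c N u + K • u) η = ∑ y ∈ Finset.Icc (-N : ℤ) N, c (trans y η) * u (exch y η) +
      (K - ∑ y ∈ Finset.Icc (-N : ℤ) N, c (trans y η)) * u η := by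
  rw [Obs.add_apply, exclOp_apply, Obs.smul_apply, sub_mul,
    Finset.sum_mul, ← sub_eq_zero]
  simp only [mul_sub, Finset.sum_sub_distrib]
  ring

lemma norm_exclOp_add_le {c : Obs} (hc : ∀ η, 0 ≤ c η) (N : ℕ) {K : ℝ} (hK : boxRate c N ≤ K)
    (u : Obs) : ‖exclOp c N u + K • u‖ ≤ K * ‖u‖ := by
  have hK0 : 0 ≤ K := (boxRate_nonneg c N).trans hK
  refine (Obs.norm_le (by positivity)).2 fun η => ?_
  rw [exclOp_add_apply]
  have h0 : 0 ≤ K - ∑ y ∈ Finset.Icc (-N : ℤ) N, c (trans y η) :=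
    sub_nonneg.2 ((sum_rate_le c N η).trans hK)
  calc _ ≤ ∑ y ∈ Finset.Icc (-N : ℤ) N, c (trans y η) * ‖u‖ +
      (K - ∑ y ∈ Finset.Icc (-N : ℤ) N, c (trans y η)) * ‖u‖ := by
        refine (abs_add_le _ _).trans (add_le_add ?_ ?_)
        · refine (Finset.abs_sum_le_sum_abs _ _).trans (Finset.sum_le_sum fun y _ => ?_)
          rw [abs_mul, abs_of_nonneg (hc _)]
          exact mul_le_mul_of_nonneg_left (u.abs_le_norm _) (hc _)
        · rw [abs_mul, abs_of_nonneg h0]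
          exact mul_le_mul_of_nonneg_left (u.abs_le_norm _) h0
    _ = _ := by rw [← Finset.sum_mul]; ring

/-- The exchanges move the oscillation at `x` to a neighbouring site at most. -/
lemma sum_rate_mul_abs_exch_flip_le {c : Obs} (hc : ∀ η, 0 ≤ c η) (I : Finset ℤ) (u : Obs) (x : ℤ)
    (η : Config) :
    |∑ y ∈ I, c (trans y η) * (u (exch y (flip x η)) - u (exch y η))| ≤
      (∑ y ∈ I, c (trans y η)) * osc x u + ‖c‖ * (osc (x - 1) u + osc (x - (-1)) u) := by
  have h2 : ∀ x, 0 ≤ osc x u := fun x => osc_nonneg x u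
  have hn := norm_nonneg c
  have h5 := mul_nonneg hn (h2 (x - 1))
  have h6 := mul_nonneg hn (h2 (x - (-1)))
  have b : ∀ y ∈ I, |c (trans y η) * (u (exch y (flip x η)) - u (exch y η))| ≤
      c (trans y η) * osc x u + ((if y = x - 1 then ‖c‖ * osc (x - 1) u else 0) +
        (if y = x then ‖c‖ * osc (x - (-1)) u else 0)) := by
    intro y _
    rw [abs_mul, abs_of_nonneg (hc _), exch_flip]
    have h3 := abs_flip_sub_le (Equiv.swap y (y + 1) x) u (exch y η)
    have h4 : c (trans y η) * |u (flip (Equiv.swap y (y + 1) x) (exch y η)) - u (exch y η)|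
        ≤ c (trans y η) * osc (Equiv.swap y (y + 1) x) u :=
      mul_le_mul_of_nonneg_left h3 (hc _)
    refine h4.trans ?_
    have hcn := c.apply_le_norm (trans y η)
    have hc0 := hc (trans y η)
    by_cases hy1 : y = x - 1
    · have : Equiv.swap y (y + 1) x = x - 1 := by
        subst hy1; rw [sub_add_cancel, Equiv.swap_apply_right]
      rw [this, if_pos hy1, if_neg (by omega), add_zero]
      have := mul_nonneg hc0 (h2 x)
      have := mul_le_mul_of_nonneg_right hcn (h2 (x - 1))
      linarith
    · by_cases hy2 : y = x
      · have : Equiv.swap y (y + 1) x = x - (-1) := by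
          subst hy2; rw [Equiv.swap_apply_left]; ring
        rw [this, if_neg hy1, if_pos hy2, zero_add]
        have := mul_nonneg hc0 (h2 x)
        have := mul_le_mul_of_nonneg_right hcn (h2 (x - (-1)))
        linarith
      · rw [Equiv.swap_apply_of_ne_of_ne (by omega) (by omega), if_neg hy1, if_neg hy2]
        simp
  refine (Finset.abs_sum_le_sum_abs _ _).trans ((Finset.sum_le_sum b).trans ?_)
  rw [Finset.sum_add_distrib, Finset.sum_add_distrib, Finset.sum_mul, Finset.sum_ite_eq',
    Finset.sum_ite_eq', mul_add]
  refine add_le_add le_rfl (add_le_add ?_ ?_)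
  · split_ifs
    · exact le_rfl
    · exact h5
  · split_ifs
    · exact le_rfl
    · exact h6

/-- The dependence of the rates on the site `x` creates oscillation from that of the bonds at a
bounded distance from `x`. -/
lemma sum_rate_flip_sub_mul_le {c : Obs} {A : Finset ℤ} (hA : DependsOn c (A : Set ℤ))
    (I : Finset ℤ) (u : Obs) (x : ℤ) (η : Config) :
    |∑ y ∈ I, (c (trans y (flip x η)) - c (trans y η)) *
        (u (exch y (flip x η)) - u (flip x η))| ≤
      2 * ‖c‖ * ∑ a ∈ A, (osc (x - a) u + osc (x - (a - 1)) u) := by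
  have h2 : ∀ x, 0 ≤ osc x u := fun x => osc_nonneg x u
  have b : ∀ y ∈ I, |(c (trans y (flip x η)) - c (trans y η)) *
      (u (exch y (flip x η)) - u (flip x η))| ≤
      if x - y ∈ A then 2 * ‖c‖ * (osc y u + osc (y + 1) u) else 0 := by
    intro y _
    rw [abs_mul]
    split_ifs with h
    · exact mul_le_mul (c.abs_sub_le_two_norm _ _) (abs_exch_sub_le _ _ _) (abs_nonneg _)
        (by positivity)
    · rw [trans_flip, dependsOn_flip hA (by simpa using h)]
      simp
  refine (Finset.abs_sum_le_sum_abs _ _).trans ((Finset.sum_le_sum b).trans ?_)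
  rw [← Finset.sum_filter, ← Finset.mul_sum]
  refine mul_le_mul_of_nonneg_left ?_ (by positivity)
  calc _ ≤ ∑ y ∈ A.image (fun a => x - a), (osc y u + osc (y + 1) u) := by
        refine Finset.sum_le_sum_of_subset_of_nonneg ?_ fun _ _ _ => add_nonneg (h2 _) (h2 _)
        intro y hy
        rw [Finset.mem_image]
        exact ⟨x - y, (Finset.mem_filter.1 hy).2, by ring⟩
    _ = _ := by
        rw [Finset.sum_image (by intro a _ b _ h; simpa using h)]
        refine Finset.sum_congr rfl fun a _ => ?_
        congr 2; ring

/-- How the oscillations evolve in one step: the terms that grow with the box are all absorbed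
into `K`. -/
lemma osc_exclOp_add_le {c : Obs} (hc : ∀ η, 0 ≤ c η) {A : Finset ℤ} (hA : DependsOn c (A : Set ℤ))
    (N : ℕ) {K : ℝ} (hK : boxRate c N ≤ K) (u : Obs) (x : ℤ) :
    osc x (exclOp c N u + K • u) ≤ K * osc x u + ‖c‖ * (osc (x - 1) u + osc (x - (-1)) u) +
      2 * ‖c‖ * ∑ a ∈ A, (osc (x - a) u + osc (x - (a - 1)) u) := by
  have hK0 : 0 ≤ K := (boxRate_nonneg c N).trans hK
  have h2 : ∀ x, 0 ≤ osc x u := fun x => osc_nonneg x u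
  have hsum : 0 ≤ ∑ a ∈ A, (osc (x - a) u + osc (x - (a - 1)) u) :=
    Finset.sum_nonneg fun a _ => add_nonneg (h2 _) (h2 _)
  have hn := norm_nonneg c
  refine osc_le ?_ fun η => ?_
  · exact add_nonneg (add_nonneg (mul_nonneg hK0 (h2 x))
      (mul_nonneg hn (add_nonneg (h2 _) (h2 _)))) (mul_nonneg (by positivity) hsum)
  have h0 : 0 ≤ K - ∑ y ∈ Finset.Icc (-N : ℤ) N, c (trans y η) :=
    sub_nonneg.2 ((sum_rate_le c N η).trans hK)
  have b1 := sum_rate_mul_abs_exch_flip_le hc (Finset.Icc (-N : ℤ) N) u x η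
  have b3 := sum_rate_flip_sub_mul_le hA (Finset.Icc (-N : ℤ) N) u x η
  have b2 : |(K - ∑ y ∈ Finset.Icc (-N : ℤ) N, c (trans y η)) * (u (flip x η) - u η)| ≤
      (K - ∑ y ∈ Finset.Icc (-N : ℤ) N, c (trans y η)) * osc x u := by
    rw [abs_mul, abs_of_nonneg h0]
    exact mul_le_mul_of_nonneg_left (abs_flip_sub_le _ _ _) h0
  have e : (exclOp c N u + K • u) (flip x η) - (exclOp c N u + K • u) η =
      ∑ y ∈ Finset.Icc (-N : ℤ) N, c (trans y η) * (u (exch y (flip x η)) - u (exch y η)) +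
      (K - ∑ y ∈ Finset.Icc (-N : ℤ) N, c (trans y η)) * (u (flip x η) - u η) +
      ∑ y ∈ Finset.Icc (-N : ℤ) N, (c (trans y (flip x η)) - c (trans y η)) *
        (u (exch y (flip x η)) - u (flip x η)) := by
    rw [exclOp_add_apply, exclOp_add_apply]
    simp only [mul_sub, sub_mul, Finset.sum_sub_distrib, Finset.sum_mul]
    ring
  rw [e]
  refine (abs_add_three _ _ _).trans ?_
  linarith

/-- The rate at which `oscNorm` may grow under the exclusion dynamics, the same for all boxes. -/
def growthRate (c : Obs) (A : Finset ℤ) : ℝ≥0∞ :=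
  ENNReal.ofReal ‖c‖ * (weight 1 + weight (-1)) +
    2 * ENNReal.ofReal ‖c‖ * ∑ a ∈ A, (weight a + weight (a - 1))

lemma growthRate_ne_top (c : Obs) (A : Finset ℤ) : growthRate c A ≠ ⊤ := by
  unfold growthRate
  refine ENNReal.add_ne_top.2 ⟨ENNReal.mul_ne_top ENNReal.ofReal_ne_top
    (ENNReal.add_ne_top.2 ⟨weight_ne_top _, weight_ne_top _⟩),
    ENNReal.mul_ne_top (ENNReal.mul_ne_top (by simp) ENNReal.ofReal_ne_top)
    (ENNReal.sum_ne_top.2 fun a _ => ENNReal.add_ne_top.2 ⟨weight_ne_top _, weight_ne_top _⟩)⟩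

lemma ofReal_osc_exclOp_add_le {c : Obs} (hc : ∀ η, 0 ≤ c η) {A : Finset ℤ}
    (hA : DependsOn c (A : Set ℤ)) (N : ℕ) {K : ℝ} (hK : boxRate c N ≤ K) (u : Obs)
    {o : ℤ → ℝ≥0∞} (ho : ∀ x, o x = ENNReal.ofReal (osc x u)) (x : ℤ) :
    ENNReal.ofReal (osc x (exclOp c N u + K • u)) ≤
      ENNReal.ofReal K * o x + (ENNReal.ofReal ‖c‖ * (o (x - 1) + o (x - (-1))) +
        2 * ENNReal.ofReal ‖c‖ * ∑ a ∈ A, (o (x - a) + o (x - (a - 1)))) := by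
  have hK0 : 0 ≤ K := (boxRate_nonneg c N).trans hK
  have h3 : ∀ x, 0 ≤ osc x u := fun x => osc_nonneg x u
  have hn := norm_nonneg c
  have hsum : 0 ≤ ∑ a ∈ A, (osc (x - a) u + osc (x - (a - 1)) u) :=
    Finset.sum_nonneg fun a _ => add_nonneg (h3 _) (h3 _)
  have p1 := mul_nonneg hK0 (h3 x)
  have p2 := mul_nonneg hn (add_nonneg (h3 (x - 1)) (h3 (x - (-1))))
  have p3 : 0 ≤ 2 * ‖c‖ * ∑ a ∈ A, (osc (x - a) u + osc (x - (a - 1)) u) :=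
    mul_nonneg (by positivity) hsum
  refine (ENNReal.ofReal_le_ofReal (osc_exclOp_add_le hc hA N hK u x)).trans (le_of_eq ?_)
  rw [ENNReal.ofReal_add (add_nonneg p1 p2) p3, ENNReal.ofReal_add p1 p2, ENNReal.ofReal_mul hK0,
    ENNReal.ofReal_mul hn, ENNReal.ofReal_mul (by positivity), ENNReal.ofReal_mul (by positivity),
    ENNReal.ofReal_add (h3 _) (h3 _),
    ENNReal.ofReal_sum_of_nonneg fun a _ => add_nonneg (h3 _) (h3 _), ENNReal.ofReal_ofNat,
    ← ho, ← ho, ← ho, add_assoc]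
  congr 3
  refine Finset.sum_congr rfl fun a _ => ?_
  rw [ENNReal.ofReal_add (h3 _) (h3 _), ho, ho]

lemma tsum_weight_mul_growth_le (o : ℤ → ℝ≥0∞) (k b : ℝ≥0∞) (A : Finset ℤ) :
    ∑' x, weight x * (k * o x + (b * (o (x - 1) + o (x - (-1))) +
        2 * b * ∑ a ∈ A, (o (x - a) + o (x - (a - 1))))) ≤
      (k + (b * (weight 1 + weight (-1)) + 2 * b * ∑ a ∈ A, (weight a + weight (a - 1)))) *
        ∑' x, weight x * o x := by
  have e : ∀ x, weight x * (k * o x + (b * (o (x - 1) + o (x - (-1))) +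
        2 * b * ∑ a ∈ A, (o (x - a) + o (x - (a - 1))))) =
      k * (weight x * o x) + (b * (weight x * o (x - 1) + weight x * o (x - (-1))) +
        2 * b * ∑ a ∈ A, (weight x * o (x - a) + weight x * o (x - (a - 1)))) := by
    intro x
    simp only [← mul_add, ← Finset.mul_sum]
    ring
  simp only [e]
  rw [ENNReal.tsum_add, ENNReal.tsum_add, ENNReal.tsum_mul_left, ENNReal.tsum_mul_left,
    ENNReal.tsum_mul_left, ENNReal.tsum_add, Summable.tsum_finsetSum fun _ _ => ENNReal.summable]
  simp only [ENNReal.tsum_add]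
  rw [add_mul, add_mul, mul_assoc b, mul_assoc (2 * b), add_mul, Finset.sum_mul]
  refine add_le_add le_rfl (add_le_add ?_ ?_)
  · exact mul_le_mul_right (add_le_add (tsum_weight_shift_le o _) (tsum_weight_shift_le o _)) _
  · refine mul_le_mul_right (Finset.sum_le_sum fun a _ => ?_) _
    rw [add_mul]
    exact add_le_add (tsum_weight_shift_le o _) (tsum_weight_shift_le o _)

/-- The increase of `oscNorm` beyond the factor `K` is independent of the box, since all the terms
that are not absorbed into `K` come from bonds at a bounded distance from the flipped site. -/
lemma oscNorm_exclOp_add_le {c : Obs} (hc : ∀ η, 0 ≤ c η) {A : Finset ℤ}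
    (hA : DependsOn c (A : Set ℤ)) (N : ℕ) {K : ℝ} (hK : boxRate c N ≤ K) (u : Obs) :
    oscNorm (exclOp c N u + K • u) ≤ (ENNReal.ofReal K + growthRate c A) * oscNorm u := by
  have hK0 : 0 ≤ K := (boxRate_nonneg c N).trans hK
  have h1 : ENNReal.ofReal ‖exclOp c N u + K • u‖ ≤
      (ENNReal.ofReal K + growthRate c A) * ENNReal.ofReal ‖u‖ := by
    refine (ENNReal.ofReal_le_ofReal (norm_exclOp_add_le hc N hK u)).trans ?_
    rw [ENNReal.ofReal_mul hK0]
    gcongr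
    exact le_self_add
  have h2 : totalOsc (exclOp c N u + K • u) ≤ (ENNReal.ofReal K + growthRate c A) * totalOsc u := by
    refine le_trans (ENNReal.tsum_le_tsum fun x => ?_)
      (tsum_weight_mul_growth_le (fun x => ENNReal.ofReal (osc x u)) _ _ A)
    gcongr
    exact ofReal_osc_exclOp_add_le hc hA N hK u (fun _ => rfl) x
  calc _ ≤ _ := add_le_add h1 h2
    _ = _ := by unfold oscNorm; ring

/-! ### Exponentials of bounded operators -/

section Semigroup

open NormedSpace (exp)

lemma hasSum_exp_smul_apply (B : Obs →L[ℝ] Obs) (t : ℝ) (u : Obs) :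
    HasSum (fun k : ℕ => (t ^ k / k.factorial) • (B ^ k) u) (exp (t • B) u) := by
  have h := (NormedSpace.exp_series_hasSum_exp' (𝕂 := ℝ) (t • B)).mapL
    (ContinuousLinearMap.apply ℝ Obs u)
  refine h.congr_fun fun k => ?_
  have hk : ((t • B) ^ k) u = t ^ k • (B ^ k) u := by
    induction k with
    | zero => simp
    | succ k ih =>
      rw [pow_succ' (t • B), pow_succ' B]
      change t • B (((t • B) ^ k) u) = _ • B ((B ^ k) u)
      rw [ih, map_smul, smul_smul, pow_succ']
  change _ = (k.factorial : ℝ)⁻¹ • ((t • B) ^ k) u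
  rw [hk, smul_smul, ← div_eq_inv_mul]

/-- Splitting off a multiple of the identity, for `K` the total rate of a generator `B`, turns the
exponential into a power series in an operator that preserves positivity and whose norms are
controlled. -/
lemma exp_smul_eq_exp_smul_add (B : Obs →L[ℝ] Obs) (t K : ℝ) :
    exp (t • B) = Real.exp (-(t * K)) • exp (t • (B + K • (1 : Obs →L[ℝ] Obs))) := by
  have h1 : t • B = t • (B + K • (1 : Obs →L[ℝ] Obs)) +
      algebraMap ℝ (Obs →L[ℝ] Obs) (-(t * K)) := by
    rw [Algebra.algebraMap_eq_smul_one, smul_add, smul_smul, neg_smul, add_neg_cancel_right]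
  let _ : NormedAlgebra ℚ (Obs →L[ℝ] Obs) := NormedAlgebra.restrictScalars ℚ ℝ _
  rw [h1, NormedSpace.exp_add_of_commute (Algebra.commutes _ _).symm,
    ← NormedSpace.algebraMap_exp_comm, ← Real.exp_eq_exp_ℝ, ← Algebra.commutes, ← Algebra.smul_def]

lemma oscNorm_pow_le {B : Obs →L[ℝ] Obs} {b : ℝ} (hb : 0 ≤ b)
    (hB : ∀ u, oscNorm (B u) ≤ ENNReal.ofReal b * oscNorm u) (k : ℕ) (u : Obs) :
    oscNorm ((B ^ k) u) ≤ ENNReal.ofReal (b ^ k) * oscNorm u := by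
  induction k with
  | zero => simp
  | succ k ih =>
    rw [pow_succ', pow_succ', ENNReal.ofReal_mul hb, mul_assoc]
    exact (hB _).trans (mul_le_mul_right ih _)

lemma oscNorm_exp_le {B : Obs →L[ℝ] Obs} {b : ℝ} (hb : 0 ≤ b)
    (hB : ∀ u, oscNorm (B u) ≤ ENNReal.ofReal b * oscNorm u) {t : ℝ} (ht : 0 ≤ t) (u : Obs) :
    oscNorm (exp (t • B) u) ≤ ENNReal.ofReal (Real.exp (t * b)) * oscNorm u := by
  have h := hasSum_exp_smul_apply B t u
  rw [← h.tsum_eq]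
  refine (oscNorm_tsum_le h.summable).trans ?_
  have hs : HasSum (fun k : ℕ => (t * b) ^ k / k.factorial) (Real.exp (t * b)) := by
    rw [Real.exp_eq_exp_ℝ]
    exact NormedSpace.expSeries_div_hasSum_exp (t * b)
  have hk : ∀ k : ℕ, 0 ≤ (t * b) ^ k / k.factorial := fun k => by positivity
  rw [← hs.tsum_eq, ENNReal.ofReal_tsum_of_nonneg hk hs.summable, ← ENNReal.tsum_mul_right]
  refine ENNReal.tsum_le_tsum fun k => ?_
  rw [oscNorm_smul, abs_of_nonneg (by positivity), mul_pow, mul_div_right_comm,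
    ENNReal.ofReal_mul (by positivity), mul_assoc]
  exact mul_le_mul_right (oscNorm_pow_le hb hB k u) _

lemma norm_exp_apply_le {B : Obs →L[ℝ] Obs} {b : ℝ} (hB : ‖B‖ ≤ b) {t : ℝ} (ht : 0 ≤ t) (u : Obs) :
    ‖exp (t • B) u‖ ≤ Real.exp (t * b) * ‖u‖ := by
  have hb : 0 ≤ b := (norm_nonneg _).trans hB
  have hpow : ∀ k : ℕ, ‖(B ^ k) u‖ ≤ b ^ k * ‖u‖ := by
    intro k
    induction k with
    | zero => simp
    | succ k ih =>
      rw [pow_succ', pow_succ', mul_assoc]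
      exact (B.le_opNorm _).trans (mul_le_mul hB ih (norm_nonneg _) hb)
  have hs : HasSum (fun k : ℕ => (t * b) ^ k / k.factorial) (Real.exp (t * b)) := by
    rw [Real.exp_eq_exp_ℝ]
    exact NormedSpace.expSeries_div_hasSum_exp (t * b)
  rw [← (hasSum_exp_smul_apply B t u).tsum_eq]
  refine tsum_of_norm_bounded (hs.mul_right ‖u‖) fun k => ?_
  rw [norm_smul, Real.norm_eq_abs, abs_of_nonneg (by positivity), mul_pow, mul_div_right_comm,
    mul_assoc]
  exact mul_le_mul_of_nonneg_left (hpow k) (by positivity)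

lemma hasDerivAt_exp_smul_apply (B : Obs →L[ℝ] Obs) (u : Obs) (t : ℝ) :
    HasDerivAt (fun s : ℝ => exp (s • B) u) (exp (t • B) (B u)) t := by
  simpa using (hasDerivAt_exp_smul_const B t).clm_apply (hasDerivAt_const t u)

lemma exp_smul_apply_comm (B : Obs →L[ℝ] Obs) (t : ℝ) (u : Obs) :
    exp (t • B) (B u) = B (exp (t • B) u) := by
  have h1 := (hasDerivAt_exp_smul_const B t).unique (hasDerivAt_exp_smul_const' B t)
  exact DFunLike.congr_fun h1 u

/-! ### The dynamics in a box, uniformly in the box -/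

/-- The exclusion dynamics in a box, together with another bounded operator `M`. -/
def boxOp (c : Obs) (M : Obs →L[ℝ] Obs) (N : ℕ) : Obs →L[ℝ] Obs := exclOp c N + M

/-- The semigroup generated by `boxOp c M N`. -/
def boxSemigroup (c : Obs) (M : Obs →L[ℝ] Obs) (N : ℕ) (t : ℝ) : Obs →L[ℝ] Obs :=
  exp (t • boxOp c M N)

lemma boxSemigroup_zero (c : Obs) (M : Obs →L[ℝ] Obs) (N : ℕ) (u : Obs) :
    boxSemigroup c M N 0 u = u := by
  have h : (0 : ℝ) • boxOp c M N = 0 := ContinuousLinearMap.ext fun v => zero_smul ℝ _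
  rw [boxSemigroup, h, NormedSpace.exp_zero]
  rfl

lemma hasDerivAt_boxSemigroup (c : Obs) (M : Obs →L[ℝ] Obs) (N : ℕ) (u : Obs) (t : ℝ) :
    HasDerivAt (fun s => boxSemigroup c M N s u) (boxSemigroup c M N t (boxOp c M N u)) t :=
  hasDerivAt_exp_smul_apply _ _ _

lemma boxSemigroup_comm (c : Obs) (M : Obs →L[ℝ] Obs) (N : ℕ) (u : Obs) (t : ℝ) :
    boxSemigroup c M N t (boxOp c M N u) = boxOp c M N (boxSemigroup c M N t u) :=
  exp_smul_apply_comm _ _ _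

lemma continuous_boxSemigroup (c : Obs) (M : Obs →L[ℝ] Obs) (N : ℕ) (u : Obs) :
    Continuous fun s => boxSemigroup c M N s u :=
  continuous_iff_continuousAt.2 fun t => (hasDerivAt_boxSemigroup c M N u t).continuousAt

lemma norm_boxSemigroup_le {c : Obs} (hc : ∀ η, 0 ≤ c η) (M : Obs →L[ℝ] Obs) (N : ℕ) {t : ℝ}
    (ht : 0 ≤ t) (u : Obs) : ‖boxSemigroup c M N t u‖ ≤ Real.exp (t * ‖M‖) * ‖u‖ := by
  have hK := boxRate_nonneg c N
  rw [boxSemigroup, exp_smul_eq_exp_smul_add _ _ (boxRate c N), smul_apply,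
    norm_smul, Real.norm_eq_abs, Real.abs_exp]
  have hB : ‖boxOp c M N + boxRate c N • (1 : Obs →L[ℝ] Obs)‖ ≤ boxRate c N + ‖M‖ := by
    rw [boxOp, add_right_comm]
    refine (norm_add_le _ _).trans (add_le_add ?_ le_rfl)
    exact ContinuousLinearMap.opNorm_le_bound _ hK fun u => norm_exclOp_add_le hc N le_rfl u
  calc _ ≤ Real.exp (-(t * boxRate c N)) * (Real.exp (t * (boxRate c N + ‖M‖)) * ‖u‖) := by
        gcongr
        exact norm_exp_apply_le hB ht u
    _ = _ := by
        rw [← mul_assoc, ← Real.exp_add]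
        congr 2
        ring

/-- The semigroups of the boxes increase `oscNorm` at a bounded rate that is the same for all
boxes. -/
lemma oscNorm_boxSemigroup_le {c : Obs} (hc : ∀ η, 0 ≤ c η) {A : Finset ℤ}
    (hA : DependsOn c (A : Set ℤ)) {M : Obs →L[ℝ] Obs} {m : ℝ} (hm : 0 ≤ m)
    (hM : ∀ u, oscNorm (M u) ≤ ENNReal.ofReal m * oscNorm u) (N : ℕ) {t : ℝ} (ht : 0 ≤ t)
    (u : Obs) : oscNorm (boxSemigroup c M N t u) ≤
      ENNReal.ofReal (Real.exp (t * ((growthRate c A).toReal + m))) * oscNorm u := by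
  have hK := boxRate_nonneg c N
  set g := (growthRate c A).toReal with hg
  have hg0 : 0 ≤ g := ENNReal.toReal_nonneg
  have hB : ∀ u, oscNorm ((boxOp c M N + boxRate c N • (1 : Obs →L[ℝ] Obs)) u) ≤
      ENNReal.ofReal (boxRate c N + g + m) * oscNorm u := by
    intro u
    have e : (boxOp c M N + boxRate c N • (1 : Obs →L[ℝ] Obs)) u =
        (exclOp c N u + boxRate c N • u) + M u := by
      rw [boxOp, add_right_comm]; rfl
    rw [e, ENNReal.ofReal_add (add_nonneg hK hg0) hm, ENNReal.ofReal_add hK hg0, hg,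
      ENNReal.ofReal_toReal (growthRate_ne_top c A), add_mul]
    exact (oscNorm_add_le _ _).trans
      (add_le_add (oscNorm_exclOp_add_le hc hA N le_rfl u) (hM u))
  rw [boxSemigroup, exp_smul_eq_exp_smul_add _ _ (boxRate c N), smul_apply,
    oscNorm_smul, Real.abs_exp]
  refine (mul_le_mul_right (oscNorm_exp_le (by positivity) hB ht u) _).trans (le_of_eq ?_)
  rw [← mul_assoc, ← ENNReal.ofReal_mul (Real.exp_nonneg _), ← Real.exp_add]
  congr 3
  ring

/-- Far from the origin the oscillations are small, as they are weighted. -/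
lemma sum_osc_le {u : Obs} (hu : oscNorm u ≠ ⊤) {N : ℕ} {D : Finset ℤ}
    (hD : ∀ y ∈ D, N ≤ y.natAbs) : (N + 1) * ∑ y ∈ D, osc y u ≤ (oscNorm u).toReal := by
  have h0 : ∀ y ∈ D, 0 ≤ osc y u := fun y _ => osc_nonneg y u
  rw [← ENNReal.ofReal_le_iff_le_toReal hu, ENNReal.ofReal_mul (by positivity),
    ENNReal.ofReal_sum_of_nonneg h0, Finset.mul_sum]
  refine le_trans ?_ ((ENNReal.sum_le_tsum D).trans (totalOsc_le_oscNorm u))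
  refine Finset.sum_le_sum fun y hy => ?_
  gcongr
  have : ((N : ℝ) + 1) = ((N + 1 : ℕ) : ℝ) := by push_cast; rfl
  rw [this, ENNReal.ofReal_natCast, weight]
  exact_mod_cast Nat.add_le_add_right (hD y hy) 1

/-- The generators of two boxes differ by the bonds at distance more than `N` from the origin. -/
lemma norm_boxOp_sub_le (c : Obs) (M : Obs →L[ℝ] Obs) {N N' : ℕ} (hN : N ≤ N')
    {u : Obs} (hu : oscNorm u ≠ ⊤) :
    ‖boxOp c M N' u - boxOp c M N u‖ ≤ 2 * ‖c‖ * (oscNorm u).toReal / (N + 1) := by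
  have hT : 0 ≤ (oscNorm u).toReal := ENNReal.toReal_nonneg
  refine (Obs.norm_le (by positivity)).2 fun η => ?_
  set D := Finset.Icc (-N' : ℤ) N' \ Finset.Icc (-N : ℤ) N with hD
  have hsub : Finset.Icc (-N : ℤ) N ⊆ Finset.Icc (-N' : ℤ) N' :=
    Finset.Icc_subset_Icc (by omega) (by omega)
  have e : (boxOp c M N' u - boxOp c M N u) η =
      ∑ y ∈ D, c (trans y η) * (u (exch y η) - u η) := by
    have h3 : (boxOp c M N' u - boxOp c M N u) η = exclOp c N' u η - exclOp c N u η := by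
      simp only [boxOp, add_apply, Obs.sub_apply,
        Obs.add_apply]
      ring
    rw [h3, exclOp_apply, exclOp_apply, hD, ← Finset.sum_sdiff hsub, add_sub_cancel_right]
  have hDy : ∀ y ∈ D, (N : ℤ) < y ∨ y < -N := by
    intro y hy
    rw [hD, Finset.mem_sdiff, Finset.mem_Icc, Finset.mem_Icc] at hy
    omega
  have h1 := sum_osc_le hu (N := N) (D := D) fun y hy => by have := hDy y hy; omega
  have h2 := sum_osc_le hu (N := N) (D := D.image (· + 1)) fun y hy => by
    obtain ⟨x, hx, rfl⟩ := Finset.mem_image.1 hy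
    have := hDy x hx
    omega
  rw [Finset.sum_image (by intro a _ b _ h; simpa using h)] at h2
  rw [e, le_div_iff₀ (by positivity)]
  calc _ ≤ (∑ y ∈ D, ‖c‖ * (osc y u + osc (y + 1) u)) * (N + 1) := by
        refine mul_le_mul_of_nonneg_right ?_ (by positivity)
        refine (Finset.abs_sum_le_sum_abs _ _).trans (Finset.sum_le_sum fun y _ => ?_)
        rw [abs_mul]
        exact mul_le_mul (c.abs_le_norm _) (abs_exch_sub_le _ _ _) (abs_nonneg _)
          (norm_nonneg _)
    _ = ‖c‖ * ((N + 1) * ∑ y ∈ D, osc y u + (N + 1) * ∑ y ∈ D, osc (y + 1) u) := by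
        rw [← Finset.mul_sum, Finset.sum_add_distrib]; ring
    _ ≤ ‖c‖ * ((oscNorm u).toReal + (oscNorm u).toReal) := by gcongr
    _ = _ := by ring

lemma boxSemigroup_oscNorm_ne_top {c : Obs} (hc : ∀ η, 0 ≤ c η) {A : Finset ℤ}
    (hA : DependsOn c (A : Set ℤ)) {M : Obs →L[ℝ] Obs} {m : ℝ} (hm : 0 ≤ m)
    (hM : ∀ u, oscNorm (M u) ≤ ENNReal.ofReal m * oscNorm u) (N : ℕ) {t : ℝ} (ht : 0 ≤ t)
    {u : Obs} (hu : oscNorm u ≠ ⊤) : oscNorm (boxSemigroup c M N t u) ≠ ⊤ :=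
  ne_top_of_le_ne_top (ENNReal.mul_ne_top ENNReal.ofReal_ne_top hu)
    (oscNorm_boxSemigroup_le hc hA hm hM N ht u)

lemma toReal_oscNorm_boxSemigroup_le {c : Obs} (hc : ∀ η, 0 ≤ c η) {A : Finset ℤ}
    (hA : DependsOn c (A : Set ℤ)) {M : Obs →L[ℝ] Obs} {m : ℝ} (hm : 0 ≤ m)
    (hM : ∀ u, oscNorm (M u) ≤ ENNReal.ofReal m * oscNorm u) (N : ℕ) {t : ℝ} (ht : 0 ≤ t)
    {u : Obs} (hu : oscNorm u ≠ ⊤) : (oscNorm (boxSemigroup c M N t u)).toReal ≤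
      Real.exp (t * ((growthRate c A).toReal + m)) * (oscNorm u).toReal := by
  have h := ENNReal.toReal_mono (ENNReal.mul_ne_top ENNReal.ofReal_ne_top hu)
    (oscNorm_boxSemigroup_le hc hA hm hM N ht u)
  rwa [ENNReal.toReal_mul, ENNReal.toReal_ofReal (Real.exp_nonneg _)] at h

/-- The semigroups of two boxes are compared by interpolating between them. -/
lemma norm_boxSemigroup_sub_le {c : Obs} (hc : ∀ η, 0 ≤ c η) {A : Finset ℤ}
    (hA : DependsOn c (A : Set ℤ)) {M : Obs →L[ℝ] Obs} {m : ℝ} (hm : 0 ≤ m)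
    (hM : ∀ u, oscNorm (M u) ≤ ENNReal.ofReal m * oscNorm u) {N N' : ℕ} (hN : N ≤ N') {t T : ℝ}
    (ht : 0 ≤ t) (htT : t ≤ T) {u : Obs} (hu : oscNorm u ≠ ⊤) :
    ‖boxSemigroup c M N' t u - boxSemigroup c M N t u‖ ≤
      Real.exp (T * ‖M‖) * (2 * ‖c‖ * (Real.exp (T * ((growthRate c A).toReal + m)) *
        (oscNorm u).toReal)) * T / (N + 1) := by
  have hT : 0 ≤ T := ht.trans htT
  have hQ : 0 ≤ (oscNorm u).toReal := ENNReal.toReal_nonneg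
  have hg : 0 ≤ (growthRate c A).toReal := ENNReal.toReal_nonneg
  set C := Real.exp (T * ‖M‖) * (2 * ‖c‖ * (Real.exp (T * ((growthRate c A).toReal + m)) *
        (oscNorm u).toReal) / (N + 1)) with hC
  have hC0 : 0 ≤ C := by positivity
  have hd : ∀ s, HasDerivAt (fun s => boxSemigroup c M N' (t - s) (boxSemigroup c M N s u))
      (boxSemigroup c M N' (t - s) (boxOp c M N (boxSemigroup c M N s u) -
        boxOp c M N' (boxSemigroup c M N s u))) s := by
    intro s
    have h1 := (hasDerivAt_exp_smul_const (boxOp c M N') (t - s)).scomp s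
      ((hasDerivAt_id s).const_sub t)
    have h2 := h1.clm_apply (hasDerivAt_boxSemigroup c M N u s)
    rw [boxSemigroup_comm] at h2
    refine h2.congr_deriv ?_
    rw [map_sub]
    simp [boxSemigroup]
    abel
  have hb : ∀ s ∈ Set.Ico 0 t, ‖boxSemigroup c M N' (t - s) (boxOp c M N (boxSemigroup c M N s u) -
        boxOp c M N' (boxSemigroup c M N s u))‖ ≤ C := by
    intro s hs
    have hs1 : s ≤ T := hs.2.le.trans htT
    have hQs := toReal_oscNorm_boxSemigroup_le hc hA hm hM N hs.1 hu
    refine (norm_boxSemigroup_le hc M N' (sub_nonneg.2 hs.2.le) _).trans ?_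
    rw [norm_sub_rev, hC]
    have h3 := norm_boxOp_sub_le c M hN (boxSemigroup_oscNorm_ne_top hc hA hm hM N hs.1 hu)
    refine mul_le_mul ?_ (h3.trans ?_) (norm_nonneg _) (Real.exp_nonneg _)
    · rw [Real.exp_le_exp]
      have : t - s ≤ T := by linarith [hs.1]
      gcongr
    · refine div_le_div_of_nonneg_right ?_ (by positivity)
      refine mul_le_mul_of_nonneg_left (hQs.trans ?_) (by positivity)
      gcongr
  have h := norm_image_sub_le_of_norm_deriv_le_segment' (a := 0) (b := t)
    (fun s _ => (hd s).hasDerivWithinAt) hb t ⟨ht, le_rfl⟩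
  simp only [sub_self, sub_zero, boxSemigroup_zero] at h
  rw [norm_sub_rev]
  refine h.trans ?_
  calc C * t ≤ C * T := by gcongr
    _ = _ := by rw [hC]; ring

lemma tendsto_div_natCast_add_one (C : ℝ) :
    Filter.Tendsto (fun N : ℕ => C / ((N : ℝ) + 1)) Filter.atTop (𝓝 0) := by
  simpa [div_eq_mul_inv] using (tendsto_one_div_add_atTop_nhds_zero_nat (𝕜 := ℝ)).const_mul C

/-- The semigroups of growing boxes converge, locally uniformly in time. -/
lemma exists_limit_boxSemigroup {c : Obs} (hc : ∀ η, 0 ≤ c η) {A : Finset ℤ}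
    (hA : DependsOn c (A : Set ℤ)) {M : Obs →L[ℝ] Obs} {m : ℝ} (hm : 0 ≤ m)
    (hM : ∀ u, oscNorm (M u) ≤ ENNReal.ofReal m * oscNorm u) {u : Obs} (hu : oscNorm u ≠ ⊤) :
    ∃ g : ℝ → Obs, ∀ T, 0 ≤ T → ∃ C, 0 ≤ C ∧ ∀ t, 0 ≤ t → t ≤ T → ∀ N : ℕ,
      ‖g t - boxSemigroup c M N t u‖ ≤ C / (N + 1) := by
  have hQ : 0 ≤ (oscNorm u).toReal := ENNReal.toReal_nonneg
  have h1 := tendsto_div_natCast_add_one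
  have hlim : ∀ t, ∃ v, 0 ≤ t →
      Filter.Tendsto (fun N => boxSemigroup c M N t u) Filter.atTop (𝓝 v) := by
    intro t
    by_cases ht : 0 ≤ t
    · have hcau : CauchySeq fun N => boxSemigroup c M N t u := by
        refine cauchySeq_of_le_tendsto_0' _ (fun N N' hN => ?_) (h1 (Real.exp (t * ‖M‖) *
          (2 * ‖c‖ * (Real.exp (t * ((growthRate c A).toReal + m)) * (oscNorm u).toReal)) * t))
        rw [dist_eq_norm, norm_sub_rev]
        exact norm_boxSemigroup_sub_le hc hA hm hM hN ht le_rfl hu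
      obtain ⟨v, hv⟩ := cauchySeq_tendsto_of_complete hcau
      exact ⟨v, fun _ => hv⟩
    · exact ⟨0, fun h => absurd h ht⟩
  choose g hg using hlim
  refine ⟨g, fun T hT => ⟨Real.exp (T * ‖M‖) * (2 * ‖c‖ *
    (Real.exp (T * ((growthRate c A).toReal + m)) * (oscNorm u).toReal)) * T, ?_,
    fun t ht htT N => ?_⟩⟩
  · positivity
  · refine le_of_tendsto (((hg t ht).sub_const _).norm) ?_
    filter_upwards [Filter.eventually_ge_atTop N] with N' hN'
    exact norm_boxSemigroup_sub_le hc hA hm hM hN' ht htT hu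

/-- If the generators of all boxes map `u` to the same `h`, then the limit of the evolution of `u`
is continuously differentiable in time, up to time `0`, and its derivative is the limit of the
evolution of `h`. -/
theorem exists_limit_hasDerivWithinAt {c : Obs} (hc : ∀ η, 0 ≤ c η) {A : Finset ℤ}
    (hA : DependsOn c (A : Set ℤ)) {M : Obs →L[ℝ] Obs} {m : ℝ} (hm : 0 ≤ m)
    (hM : ∀ u, oscNorm (M u) ≤ ENNReal.ofReal m * oscNorm u) {u h : Obs}
    (huh : ∀ N, boxOp c M N u = h) (hh : oscNorm h ≠ ⊤) :
    ∃ f g : ℝ → Obs,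
      (∀ t, 0 ≤ t → Filter.Tendsto (fun N => boxSemigroup c M N t u) Filter.atTop (𝓝 (f t))) ∧
      (∀ t, 0 ≤ t → Filter.Tendsto (fun N => boxSemigroup c M N t h) Filter.atTop (𝓝 (g t))) ∧
      ∀ t, 0 ≤ t → HasDerivWithinAt f (g t) (Set.Ici 0) t := by
  obtain ⟨g, hg⟩ := exists_limit_boxSemigroup hc hA hm hM hh
  have h1 := tendsto_div_natCast_add_one
  -- the limit is extended to negative times by its value at `0`
  set G : ℝ → Obs := fun t => g (max t 0)
  have hGc : Continuous G := by
    have hloc : TendstoLocallyUniformly (fun (N : ℕ) t => boxSemigroup c M N (max t 0) h) G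
        Filter.atTop := by
      rw [Metric.tendstoLocallyUniformly_iff]
      intro ε hε t
      refine ⟨Set.Iio (|t| + 1), Iio_mem_nhds (by linarith [le_abs_self t]), ?_⟩
      obtain ⟨C, -, hC⟩ := hg (|t| + 1) (by positivity)
      filter_upwards [(h1 C).eventually (gt_mem_nhds hε)] with N hN s hs
      rw [dist_eq_norm]
      exact (hC _ (le_max_right _ _) (max_le (le_of_lt hs) (by positivity)) N).trans_lt hN
    exact hloc.continuous (Filter.Frequently.of_forall fun N =>
      (continuous_boxSemigroup c M N h).comp (continuous_id.max continuous_const))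
  refine ⟨fun t => u + ∫ s in (0 : ℝ)..t, G s, g, fun t ht => ?_, fun t ht => ?_, fun t ht => ?_⟩
  · obtain ⟨C, -, hC⟩ := hg t ht
    refine tendsto_iff_norm_sub_tendsto_zero.2
      (squeeze_zero (fun _ => norm_nonneg _) (fun N => ?_) (by simpa using (h1 C).mul_const t))
    have e : boxSemigroup c M N t u = u + ∫ s in (0 : ℝ)..t, boxSemigroup c M N s h := by
      rw [intervalIntegral.integral_eq_sub_of_hasDerivAt
        (f := fun s => boxSemigroup c M N s u) (fun s _ => by
          rw [← huh N]; exact hasDerivAt_boxSemigroup c M N u s)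
        ((continuous_boxSemigroup c M N h).intervalIntegrable _ _), boxSemigroup_zero]
      abel
    rw [e, add_sub_add_left_eq_sub, ← intervalIntegral.integral_sub
      ((continuous_boxSemigroup c M N h).intervalIntegrable _ _) (hGc.intervalIntegrable _ _)]
    have hb := intervalIntegral.norm_integral_le_of_norm_le_const (a := 0) (b := t)
      (f := fun s => boxSemigroup c M N s h - G s) (C := C / (N + 1)) (fun s hs => by
        rw [Set.uIoc_of_le ht] at hs
        rw [norm_sub_rev]
        simp only [G, max_eq_left hs.1.le]
        exact hC s hs.1.le hs.2 N)
    rwa [sub_zero, abs_of_nonneg ht] at hb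
  · obtain ⟨C, -, hC⟩ := hg t ht
    refine tendsto_iff_norm_sub_tendsto_zero.2
      (squeeze_zero (fun _ => norm_nonneg _) (fun N => ?_) (h1 C))
    rw [norm_sub_rev]
    exact hC t ht le_rfl N
  · have hd := (intervalIntegral.integral_hasDerivAt_right (hGc.intervalIntegrable 0 t)
      (hGc.stronglyMeasurableAtFilter _ _) hGc.continuousAt).const_add u
    simp only [G, max_eq_left ht] at hd
    exact hd.hasDerivWithinAt

end Semigroup

/-! ### Uniqueness for the forward equation -/

lemma Obs.integrable (u : Obs) (μ : Measure Config) [IsFiniteMeasure μ] : Integrable u μ :=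
  Integrable.of_bound u.continuous.aestronglyMeasurable ‖u‖ (ae_of_all _ u.abs_le_norm)

/-- The expectation of an observable, as a bounded functional. -/
def mean (μ : Measure Config) [IsProbabilityMeasure μ] : Obs →L[ℝ] ℝ :=
  LinearMap.mkContinuous
    { toFun := fun u => ∫ η, u η ∂μ
      map_add' := fun u v => integral_add (u.integrable μ) (v.integrable μ)
      map_smul' := fun a u => integral_const_mul a u } 1 fun u => by
    have h := norm_integral_le_of_norm_le_const (μ := μ) (f := u) (C := ‖u‖)
      (ae_of_all _ u.abs_le_norm)
    rw [probReal_univ, mul_one] at h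
    rwa [one_mul]

lemma mean_apply (μ : Measure Config) [IsProbabilityMeasure μ] (u : Obs) :
    mean μ u = ∫ η, u η ∂μ := rfl

lemma abs_mean_le (μ : Measure Config) [IsProbabilityMeasure μ] (u : Obs) : |mean μ u| ≤ ‖u‖ := by
  have h := norm_integral_le_of_norm_le_const (μ := μ) (f := u) (C := ‖u‖)
      (ae_of_all _ u.abs_le_norm)
  rwa [probReal_univ, mul_one] at h

/-- The map that empties all sites outside `[-k, k]`. -/
def truncate (k : ℕ) : C(Config, Config) where
  toFun η := fun x => if x.natAbs ≤ k then η x else false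
  continuous_toFun := by
    refine continuous_pi fun x => ?_
    split_ifs
    · exact continuous_apply x
    · exact continuous_const

lemma truncate_apply (k : ℕ) (η : Config) (x : ℤ) :
    truncate k η x = if x.natAbs ≤ k then η x else false := rfl

lemma isLocal_truncate (k : ℕ) (u : Obs) : IsLocal (compOp (truncate k) u) := by
  refine ⟨Finset.Icc (-k : ℤ) k, fun η ζ h => ?_⟩
  rw [compOp_apply, compOp_apply]
  congr 1
  funext x
  rw [truncate_apply, truncate_apply]
  split_ifs with hx
  · exact h x (by rw [Finset.coe_Icc, Set.mem_Icc]; omega)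
  · rfl

lemma truncate_flip (k : ℕ) (x : ℤ) (η : Config) :
    truncate k (flip x η) = truncate k η ∨ truncate k (flip x η) = flip x (truncate k η) := by
  by_cases hx : x.natAbs ≤ k
  · right
    funext z
    rw [truncate_apply, flip_apply, flip_apply, truncate_apply, truncate_apply]
    split_ifs <;> first | rfl | simp_all
  · left
    funext z
    rw [truncate_apply, flip_apply, truncate_apply]
    split_ifs with h1 h2
    · subst h2; exact absurd h1 hx
    · rfl
    · rfl

lemma oscNorm_truncate_le (k : ℕ) (u : Obs) : oscNorm (compOp (truncate k) u) ≤ oscNorm u := by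
  refine add_le_add (ENNReal.ofReal_le_ofReal (norm_compOp_le _ _))
    (ENNReal.tsum_le_tsum fun x => ?_)
  gcongr
  refine osc_le (osc_nonneg _ _) fun η => ?_
  rw [compOp_apply, compOp_apply]
  rcases truncate_flip k x η with h | h
  · rw [h, sub_self, abs_zero]; exact osc_nonneg _ _
  · rw [h]; exact abs_flip_sub_le _ _ _

lemma tendsto_truncate (u : Obs) :
    Filter.Tendsto (fun k => compOp (truncate k) u) Filter.atTop (𝓝 u) := by
  have h1 : TendstoUniformly (fun (k : ℕ) η => truncate k η) id Filter.atTop := by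
    rw [tendstoUniformly_iff_tendsto, Pi.uniformity, Filter.tendsto_iInf]
    intro x
    rw [Filter.tendsto_comap_iff]
    refine (Filter.tendsto_principal.2 ?_).mono_right refl_le_uniformity
    have h2 : ∀ᶠ k : ℕ in Filter.atTop, x.natAbs ≤ k := Filter.eventually_ge_atTop _
    filter_upwards [h2.prod_inl ⊤] with q hq
    simp only [Function.comp, id, truncate_apply, if_pos hq, SetRel.mem_id]
  have h2 := (CompactSpace.uniformContinuous_of_continuous u.continuous).comp_tendstoUniformly h1
  rw [Metric.tendstoUniformly_iff] at h2
  rw [Metric.tendsto_nhds]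
  intro ε hε
  filter_upwards [h2 (ε / 2) (by positivity)] with k hk
  rw [dist_eq_norm]
  refine lt_of_le_of_lt ((Obs.norm_le (by positivity)).2 fun η => ?_) (half_lt_self hε)
  have := (hk η).le
  rwa [dist_comm, Real.dist_eq] at this

/-- A family of probability measures that solves the forward equation of the exclusion dynamics
with the additional operator `M` at times `t ≥ 0`, tested against local observables; on these the
generator is that of any sufficiently large box. -/
structure SolvesForward (c : Obs) (M : Obs →L[ℝ] Obs) (μ : ℝ → Measure Config)
    [∀ t, IsProbabilityMeasure (μ t)] : Prop where
  measurable_mean : ∀ u : Obs, Measurable fun s => mean (μ s) u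
  forward : ∀ g : Obs, IsLocal g → ∃ N₀ : ℕ, ∀ N, N₀ ≤ N → ∀ t, 0 ≤ t →
    mean (μ t) g = mean (μ 0) g + ∫ s in (0 : ℝ)..t, mean (μ s) (boxOp c M N g)

section Forward

variable {c : Obs} {M : Obs →L[ℝ] Obs} {μ : ℝ → Measure Config} [∀ t, IsProbabilityMeasure (μ t)]

lemma SolvesForward.intervalIntegrable (h : SolvesForward c M μ) (u : Obs) (a b : ℝ) :
    IntervalIntegrable (fun s => mean (μ s) u) volume a b :=
  (intervalIntegrable_const (c := ‖u‖)).mono_fun (h.measurable_mean u).aestronglyMeasurable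
    (ae_of_all _ fun s => by simpa using abs_mean_le (μ s) u)

lemma abs_integral_mean_le (u : Obs) {s t : ℝ} (hst : s ≤ t) :
    |∫ r in s..t, mean (μ r) u| ≤ ‖u‖ * (t - s) := by
  have h := intervalIntegral.norm_integral_le_of_norm_le_const (a := s) (b := t)
    (f := fun r => mean (μ r) u) (C := ‖u‖) fun r _ => abs_mean_le (μ r) u
  rwa [abs_of_nonneg (sub_nonneg.2 hst)] at h

lemma SolvesForward.integral_sub (h : SolvesForward c M μ) (u v : Obs) (s t : ℝ) :
    ∫ r in s..t, mean (μ r) (u - v) =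
      (∫ r in s..t, mean (μ r) u) - ∫ r in s..t, mean (μ r) v := by
  simp only [map_sub]
  exact intervalIntegral.integral_sub (h.intervalIntegrable u _ _) (h.intervalIntegrable v _ _)

lemma SolvesForward.abs_sub_le_of_isLocal (h : SolvesForward c M μ) {g : Obs} (hg : IsLocal g)
    (N : ℕ) {s t : ℝ} (hs : 0 ≤ s) (hst : s ≤ t) :
    |mean (μ t) g - mean (μ s) g - ∫ r in s..t, mean (μ r) (boxOp c M N g)| ≤
      2 * ‖c‖ * (oscNorm g).toReal / (N + 1) * (t - s) := by
  obtain ⟨N₀, h₀⟩ := h.forward g hg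
  set N' := max N N₀
  have ht := h₀ N' (le_max_right _ _) t (hs.trans hst)
  have hs' := h₀ N' (le_max_right _ _) s hs
  have e : mean (μ t) g - mean (μ s) g - ∫ r in s..t, mean (μ r) (boxOp c M N g) =
      ∫ r in s..t, mean (μ r) (boxOp c M N' g - boxOp c M N g) := by
    rw [h.integral_sub, ← intervalIntegral.integral_interval_sub_left
      (h.intervalIntegrable (boxOp c M N' g) 0 t) (h.intervalIntegrable _ 0 s), ht, hs']
    ring
  rw [e]
  refine (abs_integral_mean_le _ hst).trans (mul_le_mul_of_nonneg_right ?_ (sub_nonneg.2 hst))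
  exact norm_boxOp_sub_le c M (le_max_left _ _) (oscNorm_ne_top_of_isLocal hg)

/-- The forward equation of a box holds up to a small error for all observables with finite
`oscNorm`, by approximation with local ones. -/
lemma SolvesForward.abs_sub_le (h : SolvesForward c M μ) {u : Obs} (hu : oscNorm u ≠ ⊤)
    (N : ℕ) {s t : ℝ} (hs : 0 ≤ s) (hst : s ≤ t) :
    |mean (μ t) u - mean (μ s) u - ∫ r in s..t, mean (μ r) (boxOp c M N u)| ≤
      2 * ‖c‖ * (oscNorm u).toReal / (N + 1) * (t - s) := by
  have hk := tendsto_truncate u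
  have h1 : ∀ r, Filter.Tendsto (fun k => mean (μ r) (compOp (truncate k) u)) Filter.atTop
      (𝓝 (mean (μ r) u)) := fun r => ((mean (μ r)).continuous.tendsto u).comp hk
  have h2 : Filter.Tendsto (fun k => ∫ r in s..t, mean (μ r)
      (boxOp c M N (compOp (truncate k) u))) Filter.atTop
      (𝓝 (∫ r in s..t, mean (μ r) (boxOp c M N u))) := by
    have h3 := ((boxOp c M N).continuous.tendsto u).comp hk
    rw [tendsto_iff_norm_sub_tendsto_zero] at h3 ⊢
    refine squeeze_zero (fun _ => norm_nonneg _) (fun k => ?_) (by simpa using h3.mul_const (t - s))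
    rw [← h.integral_sub]
    exact abs_integral_mean_le _ hst
  refine le_of_tendsto (((h1 t).sub (h1 s)).sub h2).abs (Filter.Eventually.of_forall fun k => ?_)
  refine (h.abs_sub_le_of_isLocal (isLocal_truncate k u) N hs hst).trans ?_
  have h4 := ENNReal.toReal_mono hu (oscNorm_truncate_le k u)
  have h5 := sub_nonneg.2 hst
  gcongr

lemma SolvesForward.exists_lipschitz (h : SolvesForward c M μ) {u : Obs} (hu : oscNorm u ≠ ⊤) :
    ∃ L, 0 ≤ L ∧ ∀ s t, 0 ≤ s → 0 ≤ t → |mean (μ t) u - mean (μ s) u| ≤ L * |t - s| := by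
  refine ⟨‖boxOp c M 0 u‖ + 2 * ‖c‖ * (oscNorm u).toReal / ((0 : ℕ) + 1), by positivity, ?_⟩
  have key : ∀ s t, 0 ≤ s → s ≤ t → |mean (μ t) u - mean (μ s) u| ≤
      (‖boxOp c M 0 u‖ + 2 * ‖c‖ * (oscNorm u).toReal / ((0 : ℕ) + 1)) * |t - s| := by
    intro s t hs hst
    have h1 := h.abs_sub_le hu 0 hs hst
    have h2 := abs_integral_mean_le (μ := μ) (boxOp c M 0 u) hst
    have h3 := abs_sub_abs_le_abs_sub (mean (μ t) u - mean (μ s) u)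
      (∫ r in s..t, mean (μ r) (boxOp c M 0 u))
    rw [abs_of_nonneg (sub_nonneg.2 hst), add_mul]
    linarith
  intro s t hs ht
  rcases le_total s t with hst | hst
  · exact key s t hs hst
  · rw [abs_sub_comm, abs_sub_comm t s]
    exact key t s ht hst

lemma oscNorm_boxOp_ne_top (hc : ∀ η, 0 ≤ c η) {A : Finset ℤ}
    (hA : DependsOn c (A : Set ℤ)) {m : ℝ}
    (hM : ∀ u, oscNorm (M u) ≤ ENNReal.ofReal m * oscNorm u) (N : ℕ) {u : Obs}
    (hu : oscNorm u ≠ ⊤) : oscNorm (boxOp c M N u) ≠ ⊤ := by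
  have e : boxOp c M N u = (exclOp c N u + boxRate c N • u) + (-boxRate c N) • u + M u := by
    rw [neg_smul, add_neg_cancel_right]; rfl
  rw [e]
  refine ne_top_of_le_ne_top ?_
    ((oscNorm_add_le _ _).trans (add_le_add (oscNorm_add_le _ _) le_rfl))
  refine ENNReal.add_ne_top.2 ⟨ENNReal.add_ne_top.2 ⟨?_, ?_⟩, ?_⟩
  · exact ne_top_of_le_ne_top (ENNReal.mul_ne_top (ENNReal.add_ne_top.2
      ⟨ENNReal.ofReal_ne_top, growthRate_ne_top c A⟩) hu) (oscNorm_exclOp_add_le hc hA N le_rfl u)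
  · rw [oscNorm_smul]
    exact ENNReal.mul_ne_top ENNReal.ofReal_ne_top hu
  · exact ne_top_of_le_ne_top (ENNReal.mul_ne_top ENNReal.ofReal_ne_top hu) (hM u)

/-- A continuous function whose increments from any point on are at most `(ε + o(1))` times the
length of the interval. -/
lemma abs_sub_le_of_eventually_increment {φ : ℝ → ℝ} {t ε : ℝ} (ht : 0 ≤ t)
    (hφ : ContinuousOn φ (Set.Icc 0 t))
    (hinc : ∀ x ∈ Set.Ico 0 t, ∀ r, ε < r → ∀ᶠ z in 𝓝[>] x, |φ z - φ x| < r * (z - x)) :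
    |φ t - φ 0| ≤ ε * t := by
  have key : ∀ δ, 0 < δ → |φ t - φ 0| ≤ (ε + δ) * t := by
    intro δ hδ
    refine image_norm_le_of_liminf_right_slope_norm_lt_deriv_boundary (a := 0) (b := t)
      (f := fun x => φ x - φ 0) (f' := fun _ => ε) (B := fun x => (ε + δ) * x)
      (B' := fun _ => ε + δ) (hφ.sub continuousOn_const) (fun x hx r hr => ?_) (by simp)
      (by fun_prop) (fun x _ => ?_) (fun x _ _ => by linarith) ⟨ht, le_rfl⟩
    · refine Filter.Eventually.frequently ?_
      filter_upwards [hinc x hx r hr, self_mem_nhdsWithin] with z hz hzx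
      have hzx' : 0 < z - x := sub_pos.2 hzx
      rw [slope_def_field, div_lt_iff₀ hzx']
      refine lt_of_le_of_lt ?_ hz
      have := abs_sub_abs_le_abs_sub (φ z - φ 0) (φ x - φ 0)
      rw [sub_sub_sub_cancel_right] at this
      simpa using this
    · simpa using ((hasDerivAt_id x).const_mul (ε + δ)).hasDerivWithinAt
  have hlim : Filter.Tendsto (fun δ : ℝ => (ε + δ) * t) (𝓝[>] 0) (𝓝 ((ε + 0) * t)) :=
    ((continuous_const.add continuous_id).mul continuous_const).continuousAt.mono_left
      nhdsWithin_le_nhds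
  rw [add_zero] at hlim
  exact ge_of_tendsto hlim (by filter_upwards [self_mem_nhdsWithin] with δ hδ using key δ hδ)

/-- The duality between the forward equation and the semigroup of a box: up to a small error,
`s ↦ mean (μ s) (boxSemigroup c M N (t - s) u)` is constant. -/
lemma SolvesForward.abs_mean_sub_le (h : SolvesForward c M μ) (hc : ∀ η, 0 ≤ c η) {A : Finset ℤ}
    (hA : DependsOn c (A : Set ℤ)) {m : ℝ} (hm : 0 ≤ m)
    (hM : ∀ u, oscNorm (M u) ≤ ENNReal.ofReal m * oscNorm u) {u : Obs} (hu : oscNorm u ≠ ⊤)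
    (N : ℕ) {t : ℝ} (ht : 0 ≤ t) :
    |mean (μ t) u - mean (μ 0) (boxSemigroup c M N t u)| ≤
      2 * ‖c‖ * (Real.exp (t * ((growthRate c A).toReal + m)) * (oscNorm u).toReal) / (N + 1) *
        t := by
  set v : ℝ → Obs := fun s => boxSemigroup c M N (t - s) u with hv
  have hvd : ∀ s, HasDerivAt v (-boxOp c M N (v s)) s := by
    intro s
    have h1 := (hasDerivAt_boxSemigroup c M N u (t - s)).scomp s ((hasDerivAt_id s).const_sub t)
    rw [boxSemigroup_comm] at h1
    simpa [hv, Function.comp_def] using h1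
  have hvQ : ∀ s, s ≤ t → oscNorm (v s) ≠ ⊤ := fun s hs =>
    boxSemigroup_oscNorm_ne_top hc hA hm hM N (sub_nonneg.2 hs) hu
  have hΓ : 0 ≤ (growthRate c A).toReal + m := add_nonneg ENNReal.toReal_nonneg hm
  have hQ : 0 ≤ (oscNorm u).toReal := ENNReal.toReal_nonneg
  set φ : ℝ → ℝ := fun s => mean (μ s) (v s) with hφ
  have hφt : φ t = mean (μ t) u := by simp [hφ, hv, boxSemigroup_zero]
  have hφ0 : φ 0 = mean (μ 0) (boxSemigroup c M N t u) := by simp [hφ, hv]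
  rw [← hφt, ← hφ0]
  refine abs_sub_le_of_eventually_increment ht ?_ ?_
  · intro x hx
    obtain ⟨L, -, hL⟩ := h.exists_lipschitz (hvQ x hx.2)
    rw [ContinuousWithinAt, tendsto_iff_norm_sub_tendsto_zero]
    have h1 : Filter.Tendsto (fun z => ‖v z - v x‖ + L * |z - x|) (𝓝[Set.Icc 0 t] x) (𝓝 0) := by
      have h2 : Filter.Tendsto (fun z => ‖v z - v x‖ + L * |z - x|) (𝓝 x)
          (𝓝 (‖v x - v x‖ + L * |x - x|)) :=
        ((hvd x).continuousAt.sub continuousAt_const).norm.add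
          (continuousAt_const.mul (continuousAt_id.sub continuousAt_const).abs)
      simp only [sub_self, norm_zero, abs_zero, mul_zero, add_zero] at h2
      exact h2.mono_left nhdsWithin_le_nhds
    refine squeeze_zero' (Filter.Eventually.of_forall fun _ => norm_nonneg _) ?_ h1
    filter_upwards [self_mem_nhdsWithin] with z hz
    have e : φ z - φ x = mean (μ z) (v z - v x) + (mean (μ z) (v x) - mean (μ x) (v x)) := by
      simp only [hφ, map_sub]; ring
    rw [e]
    exact (norm_add_le _ _).trans (add_le_add (abs_mean_le _ _) (hL x z hx.1 hz.1))
  · intro x hx r hr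
    obtain ⟨L, hL0, hL⟩ := h.exists_lipschitz
      (oscNorm_boxOp_ne_top hc hA hM N (hvQ x hx.2.le))
    set ε := 2 * ‖c‖ * (Real.exp (t * ((growthRate c A).toReal + m)) * (oscNorm u).toReal) / (N + 1)
    have hlo := (hasDerivAt_iff_isLittleO.1 (hvd x)).def
      (show 0 < (r - ε) / 2 by linarith [sub_pos.2 hr])
    have hsm : ∀ᶠ z in 𝓝 x, L * |z - x| < (r - ε) / 2 := by
      have h2 : Filter.Tendsto (fun z => L * |z - x|) (𝓝 x) (𝓝 (L * |x - x|)) :=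
        continuousAt_const.mul (continuousAt_id.sub continuousAt_const).abs
      simp only [sub_self, abs_zero, mul_zero] at h2
      exact h2.eventually (gt_mem_nhds (by linarith [sub_pos.2 hr]))
    filter_upwards [nhdsWithin_le_nhds hlo, nhdsWithin_le_nhds hsm, self_mem_nhdsWithin,
      Ioo_mem_nhdsGT hx.2] with z hz1 hz2 hzx hzt
    have hxz : x ≤ z := le_of_lt hzx
    have hd : 0 < z - x := sub_pos.2 hzx
    -- the increment of `φ` is the error of the forward equation for `v x`, which is at most
    -- `ε (z - x)`, plus two terms of order `o(z - x)`: the derivatives of `mean (μ s) (v x)` and of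
    -- `v` cancel
    have b1 := h.abs_sub_le (hvQ x hx.2.le) N hx.1 hxz
    have b1' : 2 * ‖c‖ * (oscNorm (v x)).toReal / (N + 1) * (z - x) ≤ ε * (z - x) := by
      refine mul_le_mul_of_nonneg_right (div_le_div_of_nonneg_right
        (mul_le_mul_of_nonneg_left ?_ (by positivity)) (by positivity)) hd.le
      refine (toReal_oscNorm_boxSemigroup_le hc hA hm hM N (sub_nonneg.2 hx.2.le) hu).trans ?_
      have : t - x ≤ t := by linarith [hx.1]
      gcongr
    have b2 : |(∫ s in x..z, mean (μ s) (boxOp c M N (v x))) -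
        (z - x) * mean (μ z) (boxOp c M N (v x))| ≤ L * |z - x| * (z - x) := by
      have e : (∫ s in x..z, mean (μ s) (boxOp c M N (v x))) -
          (z - x) * mean (μ z) (boxOp c M N (v x)) =
          ∫ s in x..z, (mean (μ s) (boxOp c M N (v x)) - mean (μ z) (boxOp c M N (v x))) := by
        rw [intervalIntegral.integral_sub (h.intervalIntegrable _ _ _) intervalIntegrable_const,
          intervalIntegral.integral_const, smul_eq_mul]
      rw [e]
      have := intervalIntegral.norm_integral_le_of_norm_le_const (a := x) (b := z)
        (f := fun s => mean (μ s) (boxOp c M N (v x)) - mean (μ z) (boxOp c M N (v x)))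
        (C := L * |z - x|) (fun s hs => by
          rw [Set.uIoc_of_le hxz] at hs
          have h0 : 0 ≤ s := hx.1.trans hs.1.le
          refine (hL z s (h0.trans hs.2) h0).trans (mul_le_mul_of_nonneg_left ?_ hL0)
          rw [abs_sub_comm, abs_of_nonneg (sub_nonneg.2 hs.2), abs_of_nonneg hd.le]
          linarith [hs.1])
      simp only [Real.norm_eq_abs, abs_of_nonneg hd.le] at this ⊢
      exact this
    have b3 : |mean (μ z) (v z - v x - (z - x) • -boxOp c M N (v x))| ≤ (r - ε) / 2 * (z - x) := by
      refine (abs_mean_le _ _).trans (hz1.trans (le_of_eq ?_))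
      rw [Real.norm_eq_abs, abs_of_nonneg hd.le]
    have b2' : L * |z - x| * (z - x) < (r - ε) / 2 * (z - x) := mul_lt_mul_of_pos_right hz2 hd
    have e : φ z - φ x = (mean (μ z) (v x) - mean (μ x) (v x) -
        ∫ s in x..z, mean (μ s) (boxOp c M N (v x))) +
        ((∫ s in x..z, mean (μ s) (boxOp c M N (v x))) -
          (z - x) * mean (μ z) (boxOp c M N (v x))) +
        mean (μ z) (v z - v x - (z - x) • -boxOp c M N (v x)) := by
      simp only [hφ, map_sub, map_smul, map_neg, smul_eq_mul]
      ring
    rw [e]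
    refine lt_of_le_of_lt (abs_add_three _ _ _) ?_
    linarith

/-- A solution of the forward equation is the limit of the dynamics in large boxes. -/
theorem SolvesForward.tendsto_mean (h : SolvesForward c M μ) (hc : ∀ η, 0 ≤ c η) {A : Finset ℤ}
    (hA : DependsOn c (A : Set ℤ)) {m : ℝ} (hm : 0 ≤ m)
    (hM : ∀ u, oscNorm (M u) ≤ ENNReal.ofReal m * oscNorm u) {u : Obs} (hu : oscNorm u ≠ ⊤)
    {t : ℝ} (ht : 0 ≤ t) :
    Filter.Tendsto (fun N => mean (μ 0) (boxSemigroup c M N t u)) Filter.atTop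
      (𝓝 (mean (μ t) u)) := by
  rw [tendsto_iff_norm_sub_tendsto_zero]
  refine squeeze_zero (fun _ => norm_nonneg _) (fun N => ?_)
    (by simpa using (tendsto_div_natCast_add_one (2 * ‖c‖ *
      (Real.exp (t * ((growthRate c A).toReal + m)) * (oscNorm u).toReal))).mul_const t)
  rw [norm_sub_rev]
  exact h.abs_mean_sub_le hc hA hm hM hu N ht

end Forward

/-! ### From the martingale problem to the forward equation -/

lemma measurable_uncurry_of_isCadlag {S E : Type*} [MeasurableSpace S] [TopologicalSpace E]
    [TopologicalSpace.PseudoMetrizableSpace E] [MeasurableSpace E] [BorelSpace E]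
    {y : ℝ≥0 → S → E} (hy : ∀ t, Measurable (y t)) (hcad : ∀ ω, IsCadlag fun t => y t ω) :
    Measurable fun p : ℝ≥0 × S => y p.1 p.2 := by
  -- right-continuity: evaluate at the next point of a grid of mesh `1 / (k + 1)`
  set d : ℕ → ℝ≥0 → ℝ≥0 := fun k s => (⌊s * (k + 1)⌋₊ + 1 : ℕ) / (k + 1 : ℕ) with hd
  have hlt : ∀ k s, s ≤ d k s := by
    intro k s
    rw [hd, le_div_iff₀ (by positivity)]
    push_cast
    exact (Nat.lt_floor_add_one _).le
  have hle : ∀ k s, d k s ≤ s + 1 / ((k : ℝ≥0) + 1) := by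
    intro k s
    have h0 : (0 : ℝ≥0) < (k : ℝ≥0) + 1 := by positivity
    simp only [hd]
    push_cast
    rw [div_le_iff₀ h0, add_mul, one_div, inv_mul_cancel₀ h0.ne']
    gcongr
    exact Nat.floor_le (by positivity)
  have htend : ∀ s, Filter.Tendsto (fun k => d k s) Filter.atTop (𝓝[≥] s) := by
    intro s
    refine tendsto_nhdsWithin_iff.2 ⟨?_, Filter.Eventually.of_forall fun k => hlt k s⟩
    refine tendsto_of_tendsto_of_tendsto_of_le_of_le tendsto_const_nhds ?_ (fun k => hlt k s)
      (fun k => hle k s)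
    have := (tendsto_one_div_add_atTop_nhds_zero_nat (𝕜 := ℝ≥0)).const_add s
    simpa using this
  refine measurable_of_tendsto_metrizable (f := fun k (p : ℝ≥0 × S) => y (d k p.1) p.2) ?_ ?_
  · intro k
    have h1 : Measurable fun q : ℕ × S => y ((q.1 + 1 : ℕ) / (k + 1 : ℕ)) q.2 :=
      measurable_from_prod_countable_right fun j => by
        exact hy ((j + 1 : ℕ) / (k + 1 : ℕ))
    have h2 : Measurable fun p : ℝ≥0 × S => (⌊p.1 * (k + 1)⌋₊, p.2) :=
      (Nat.measurable_floor.comp (measurable_fst.mul_const _)).prodMk measurable_snd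
    exact h1.comp h2
  · rw [tendsto_pi_nhds]
    rintro ⟨s, ω⟩
    exact ((hcad ω s).1.tendsto).comp (htend s)

/-- The jumps of the environment seen by a walker that jumps by `z` at rate `r z`. -/
def jumpOp {R : Finset ℤ} (r : R → Obs) : Obs →L[ℝ] Obs :=
  ∑ z : R, mulOp (r z) ∘L (compOp (trans z) - 1)

lemma jumpOp_apply {R : Finset ℤ} (r : R → Obs) (u : Obs) (η : Config) :
    jumpOp r u η = ∑ z : R, r z η * (u (trans z η) - u η) := by
  have : jumpOp r u = ∑ z : R, (mulOp (r z) ∘L (compOp (trans z) - 1)) u := by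
    simp [jumpOp]
  rw [this, Obs.sum_apply]
  rfl

/-- The test function `g (τ_x η)`, cut off at `|x| ≤ k`. Without the cutoff it would not vanish
outside a finite set of positions of the walker. -/
def cutoff (g : Obs) (k : ℕ) (η : Config) (x : ℤ) : ℝ := if x.natAbs ≤ k then g (trans x η) else 0

lemma isTestFunction_cutoff {g : Obs} (hg : IsLocal g) (k : ℕ) : IsTestFunction (cutoff g k) := by
  classical
  obtain ⟨A, hA⟩ := hg
  refine ⟨⟨(Finset.Icc (-k : ℤ) k).biUnion fun x => A.image fun a => x + a, fun x => ?_⟩,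
    Finset.Icc (-k : ℤ) k, fun η x hx => ?_⟩
  · intro η ζ h
    simp only [cutoff]
    split_ifs with hx
    · refine hA fun a ha => h (x + a) ?_
      simp only [Finset.coe_biUnion, Set.mem_iUnion, Finset.coe_image, Set.mem_image]
      exact ⟨x, by rw [Finset.coe_Icc, Set.mem_Icc]; omega, a, ha, rfl⟩
    · rfl
  · rw [Finset.mem_Icc] at hx
    rw [cutoff, if_neg (by omega)]

/-- On a local observable the generator of the exclusion process is that of any large box. -/
lemma exists_tsum_eq_exclOp (c : Obs) {g : Obs} (hg : IsLocal g) :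
    ∃ N₀ : ℕ, ∀ N, N₀ ≤ N → ∀ ξ, ∑' y : ℤ, c (trans y ξ) * (g (exch y ξ) - g ξ) =
      exclOp c N g ξ := by
  obtain ⟨A, hA⟩ := hg
  refine ⟨A.sup Int.natAbs + 1, fun N hN ξ => ?_⟩
  rw [exclOp_apply, tsum_eq_sum]
  intro y hy
  have h : ∀ a ∈ A, a.natAbs ≤ A.sup Int.natAbs := fun a ha => Finset.le_sup (f := Int.natAbs) ha
  rw [Finset.mem_Icc] at hy
  have e : g (exch y ξ) = g ξ := by
    refine hA fun a ha => ?_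
    have h1 := h a ha
    change ξ (Equiv.swap y (y + 1) a) = ξ a
    rw [Equiv.swap_apply_of_ne_of_ne (by omega) (by omega)]
  rw [e, sub_self, mul_zero]

/-- The generator of the pair, applied to a function of the environment seen by the walker that is
cut off, in terms of the environment seen by the walker. -/
lemma generator_cutoff (c : Obs) {R : Finset ℤ} (r : R → Obs) (n : ℕ) (g : Obs) (k : ℕ)
    (η : Config) (x : ℤ) {N : ℕ}
    (hN : ∀ ξ, ∑' y : ℤ, c (trans y ξ) * (g (exch y ξ) - g ξ) = exclOp c N g ξ) :
    generator c (fun z => r z) n (cutoff g k) η x =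
      (n : ℝ) ^ 2 * (if x.natAbs ≤ k then exclOp c N g (trans x η) else 0) +
      (n : ℝ) * ∑ z : R, r z (trans x η) *
        ((if (x + z).natAbs ≤ k then g (trans z (trans x η)) else 0) -
          if x.natAbs ≤ k then g (trans x η) else 0) := by
  unfold generator
  congr 2
  · simp only [cutoff]
    split_ifs with hx
    · rw [← hN, ← (Equiv.addRight x).tsum_eq]
      refine tsum_congr fun y => ?_
      rw [Equiv.coe_addRight, ← exch_apply, trans_exch, add_sub_cancel_right, trans_trans]
      rfl
    · simp
  · refine Finset.sum_congr rfl fun z _ => ?_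
    simp only [cutoff]
    rw [trans_trans, add_comm x]
    rfl

lemma tendsto_generator_cutoff (c : Obs) {R : Finset ℤ} (r : R → Obs) (n : ℕ) (g : Obs)
    (η : Config) (x : ℤ) {N : ℕ}
    (hN : ∀ ξ, ∑' y : ℤ, c (trans y ξ) * (g (exch y ξ) - g ξ) = exclOp c N g ξ) :
    Filter.Tendsto (fun k => generator c (fun z => r z) n (cutoff g k) η x) Filter.atTop
      (𝓝 (boxOp ((n : ℝ) ^ 2 • c) ((n : ℝ) • jumpOp r) N g (trans x η))) := by
  refine tendsto_const_nhds.congr' ?_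
  have h : ∀ᶠ k : ℕ in Filter.atTop, ∀ z : R, (x + z).natAbs ≤ k :=
    Filter.eventually_all.2 fun z => Filter.eventually_ge_atTop _
  filter_upwards [h, Filter.eventually_ge_atTop x.natAbs] with k hk1 hk2
  rw [generator_cutoff c r n g k η x hN, if_pos hk2]
  simp only [if_pos (hk1 _), if_pos hk2]
  have e : boxOp ((n : ℝ) ^ 2 • c) ((n : ℝ) • jumpOp r) N g (trans x η) =
      exclOp ((n : ℝ) ^ 2 • c) N g (trans x η) + (n : ℝ) * jumpOp r g (trans x η) := rfl
  rw [e, exclOp_apply, exclOp_apply, jumpOp_apply]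
  simp only [Finset.mul_sum, Obs.smul_apply, mul_assoc]

lemma abs_generator_cutoff_le (c : Obs) {R : Finset ℤ} (r : R → Obs) (n : ℕ) (g : Obs) (k : ℕ)
    (η : Config) (x : ℤ) {N : ℕ}
    (hN : ∀ ξ, ∑' y : ℤ, c (trans y ξ) * (g (exch y ξ) - g ξ) = exclOp c N g ξ) :
    |generator c (fun z => r z) n (cutoff g k) η x| ≤
      (n : ℝ) ^ 2 * ‖exclOp c N g‖ + n * ∑ z : R, ‖r z‖ * (‖g‖ + ‖g‖) := by
  have hi : ∀ (p : Prop) [Decidable p] (u : Obs) (ζ : Config), |if p then u ζ else 0| ≤ ‖u‖ := by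
    intro p _ u ζ
    split_ifs
    · exact u.abs_le_norm ζ
    · simp
  rw [generator_cutoff c r n g k η x hN]
  refine (abs_add_le _ _).trans (add_le_add ?_ ?_)
  · rw [abs_mul, abs_of_nonneg (by positivity)]
    exact mul_le_mul_of_nonneg_left (hi _ _ _) (by positivity)
  · rw [abs_mul, abs_of_nonneg (by positivity)]
    refine mul_le_mul_of_nonneg_left ((Finset.abs_sum_le_sum_abs _ _).trans
      (Finset.sum_le_sum fun z _ => ?_)) (by positivity)
    rw [abs_mul]
    exact mul_le_mul ((r z).abs_le_norm _) ((abs_sub _ _).trans (add_le_add (hi _ _ _) (hi _ _ _)))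
      (abs_nonneg _) (norm_nonneg _)

lemma measurable_generator_cutoff (c : Obs) {R : Finset ℤ} (r : R → Obs) (n : ℕ) (g : Obs) (k : ℕ)
    {N : ℕ} (hN : ∀ ξ, ∑' y : ℤ, c (trans y ξ) * (g (exch y ξ) - g ξ) = exclOp c N g ξ) :
    Measurable fun p : Config × ℤ => generator c (fun z => r z) n (cutoff g k) p.1 p.2 := by
  refine measurable_from_prod_countable_left fun x => ?_
  have h : ∀ (u : Obs) (z : ℤ), Measurable fun η => u (trans z η) := fun u z =>
    (u.continuous.comp (trans z).continuous).measurable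
  have hi : ∀ (p : Prop) [Decidable p] (f : Config → ℝ), Measurable f →
      Measurable fun η => if p then f η else 0 := by
    intro p _ f hf
    split_ifs
    · exact hf
    · exact measurable_const
  simp only [generator_cutoff c r n g k _ x hN]
  refine ((hi _ _ (h _ x)).const_mul _).add (Measurable.const_mul ?_ _)
  refine Finset.measurable_sum _ fun z _ => (h _ x).mul ((hi _ _ ?_).sub (hi _ _ (h _ x)))
  exact (h g z).comp (trans x).continuous.measurable

/-- The law of the environment seen by the walker, for real times; at negative times it is the law
at time `0`. -/
def envLaw {S : Type*} [MeasurableSpace S] (P : Measure S) (η : ℝ≥0 → S → Config)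
    (x : ℝ≥0 → S → ℤ) (t : ℝ) : Measure Config := P.map (envSeen η x t.toNNReal)

lemma envSeen_eq {S : Type*} (η : ℝ≥0 → S → Config) (x : ℝ≥0 → S → ℤ) (t : ℝ≥0) (ω : S) :
    envSeen η x t ω = trans (x t ω) (η t ω) := by
  funext y
  change η t ω (y + x t ω) = η t ω (x t ω + y)
  rw [add_comm]

section Walk

variable {ρ : unitInterval} {c : Obs} {R : Finset ℤ} {r : R → Obs} {n : ℕ} {S : Type*}
  [mS : MeasurableSpace S] {P : Measure S} {𝓕 : Filtration ℝ≥0 mS} {η : ℝ≥0 → S → Config}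
  {x : ℝ≥0 → S → ℤ}

lemma IsWalkInExclusion.measurable_pair (h : IsWalkInExclusion ρ c (fun z => r z) n P 𝓕 η x) :
    Measurable fun p : ℝ × S => (η p.1.toNNReal p.2, x p.1.toNNReal p.2) := by
  have h1 := measurable_uncurry_of_isCadlag
    (fun t => (h.adapted_env t).mono (𝓕.le t) le_rfl) h.cadlag_env
  have h2 := measurable_uncurry_of_isCadlag
    (fun t => (h.adapted_walk t).mono (𝓕.le t) le_rfl) h.cadlag_walk
  have h3 : Measurable fun p : ℝ × S => (p.1.toNNReal, p.2) :=
    (measurable_real_toNNReal.comp measurable_fst).prodMk measurable_snd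
  exact (h1.comp h3).prodMk (h2.comp h3)

lemma IsWalkInExclusion.measurable_envSeen (h : IsWalkInExclusion ρ c (fun z => r z) n P 𝓕 η x) :
    Measurable fun p : ℝ × S => envSeen η x p.1.toNNReal p.2 := by
  have h1 : Measurable fun q : Config × ℤ => trans q.2 q.1 :=
    measurable_from_prod_countable_left fun z => (trans z).continuous.measurable
  simp only [envSeen_eq]
  exact h1.comp h.measurable_pair

lemma IsWalkInExclusion.measurable_envSeen_right
    (h : IsWalkInExclusion ρ c (fun z => r z) n P 𝓕 η x) (t : ℝ) :
    Measurable (envSeen η x t.toNNReal) :=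
  h.measurable_envSeen.comp measurable_prodMk_left

lemma IsWalkInExclusion.isProbabilityMeasure_envLaw [IsProbabilityMeasure P]
    (h : IsWalkInExclusion ρ c (fun z => r z) n P 𝓕 η x) (t : ℝ) :
    IsProbabilityMeasure (envLaw P η x t) :=
  Measure.isProbabilityMeasure_map (h.measurable_envSeen_right t).aemeasurable

lemma IsWalkInExclusion.envLaw_zero [IsProbabilityMeasure P]
    (h : IsWalkInExclusion ρ c (fun z => r z) n P 𝓕 η x) :
    envLaw P η x 0 = bernoulliProduct ρ := by
  rw [← h.initial_env, envLaw, Real.toNNReal_zero]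
  refine Measure.map_congr ?_
  filter_upwards [h.initial_walk] with ω hω
  rw [envSeen_eq, hω, trans_zero]

lemma IsWalkInExclusion.mean_envLaw [∀ t, IsProbabilityMeasure (envLaw P η x t)]
    (h : IsWalkInExclusion ρ c (fun z => r z) n P 𝓕 η x) (t : ℝ) (u : Obs) :
    mean (envLaw P η x t) u = ∫ ω, u (trans (x t.toNNReal ω) (η t.toNNReal ω)) ∂P := by
  rw [mean_apply, envLaw, integral_map (h.measurable_envSeen_right t).aemeasurable
    u.continuous.aestronglyMeasurable]
  simp only [envSeen_eq]

variable [IsProbabilityMeasure P]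

/-- Expectations in the martingale problem, for the functions that are cut off. -/
lemma IsWalkInExclusion.integral_cutoff (h : IsWalkInExclusion ρ c (fun z => r z) n P 𝓕 η x)
    {g : Obs} (hg : IsLocal g) (k : ℕ) {N : ℕ}
    (hN : ∀ ξ, ∑' y : ℤ, c (trans y ξ) * (g (exch y ξ) - g ξ) = exclOp c N g ξ)
    {t : ℝ} (ht : 0 ≤ t) :
    ∫ ω, cutoff g k (η t.toNNReal ω) (x t.toNNReal ω) ∂P =
      ∫ ω, cutoff g k (η 0 ω) (x 0 ω) ∂P + ∫ s in (0 : ℝ)..t,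
        ∫ ω, generator c (fun z => r z) n (cutoff g k) (η s.toNNReal ω) (x s.toNNReal ω) ∂P := by
  set G : ℝ → S → ℝ := fun s ω =>
    generator c (fun z => r z) n (cutoff g k) (η s.toNNReal ω) (x s.toNNReal ω) with hG
  have hGm : Measurable fun p : ℝ × S => G p.1 p.2 :=
    (measurable_generator_cutoff c r n g k hN).comp h.measurable_pair
  set B := (n : ℝ) ^ 2 * ‖exclOp c N g‖ + n * ∑ z : R, ‖r z‖ * (‖g‖ + ‖g‖)
  have hGb : ∀ s ω, ‖G s ω‖ ≤ B := fun s ω => abs_generator_cutoff_le c r n g k _ _ hN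
  have hGi : Integrable (Function.uncurry G) ((volume.restrict (Set.Ioc 0 t)).prod P) :=
    Integrable.of_bound hGm.aestronglyMeasurable B (ae_of_all _ fun p => hGb p.1 p.2)
  have hmart := h.martingale _ (isTestFunction_cutoff hg k)
  have hcm : Measurable fun p : Config × ℤ => cutoff g k p.1 p.2 := by
    refine measurable_from_prod_countable_left fun z => ?_
    simp only [cutoff]
    split_ifs
    · exact (g.continuous.comp (trans z).continuous).measurable
    · exact measurable_const
  have hci : Integrable (fun ω => cutoff g k (η t.toNNReal ω) (x t.toNNReal ω)) P := by
    refine Integrable.of_bound (hcm.comp (h.measurable_pair.comp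
      measurable_prodMk_left)).aestronglyMeasurable ‖g‖ (ae_of_all _ fun ω => ?_)
    simp only [cutoff]
    split_ifs
    · exact g.abs_le_norm _
    · simp
  have hE : ∫ ω, (cutoff g k (η t.toNNReal ω) (x t.toNNReal ω) - ∫ s in (0 : ℝ)..t, G s ω) ∂P =
      ∫ ω, cutoff g k (η 0 ω) (x 0 ω) ∂P := by
    have h1 := integral_condExp (𝓕.le 0) (μ := P) (f := fun ω =>
      cutoff g k (η t.toNNReal ω) (x t.toNNReal ω) - ∫ s in (0 : ℝ)..t.toNNReal, G s ω)
    rw [Real.coe_toNNReal t ht] at h1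
    rw [← h1]
    refine integral_congr_ae ?_
    have h2 := hmart.2 0 t.toNNReal (zero_le)
    simp only [Real.coe_toNNReal t ht] at h2
    filter_upwards [h2] with ω hω
    exact hω.trans (by simp)
  have hI : Integrable (fun ω => ∫ s in (0 : ℝ)..t, G s ω) P := by
    simp only [intervalIntegral.integral_of_le ht]
    exact hGi.integral_prod_right
  rw [integral_sub hci hI] at hE
  have hswap : ∫ ω, (∫ s in (0 : ℝ)..t, G s ω) ∂P = ∫ s in (0 : ℝ)..t, ∫ ω, G s ω ∂P := by
    simp only [intervalIntegral.integral_of_le ht]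
    exact (integral_integral_swap hGi).symm
  rw [← hswap, ← hE]
  ring

variable [∀ t, IsProbabilityMeasure (envLaw P η x t)]

/-- The law of the environment seen by the walker solves the forward equation. -/
theorem IsWalkInExclusion.solvesForward (h : IsWalkInExclusion ρ c (fun z => r z) n P 𝓕 η x) :
    SolvesForward ((n : ℝ) ^ 2 • c) ((n : ℝ) • jumpOp r) (envLaw P η x) where
  measurable_mean u := by
    simp only [mean_apply, envLaw]
    have e : ∀ s : ℝ, ∫ ξ, u ξ ∂(P.map (envSeen η x s.toNNReal)) =
        ∫ ω, u (envSeen η x s.toNNReal ω) ∂P := fun s =>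
      integral_map (h.measurable_envSeen_right s).aemeasurable u.continuous.aestronglyMeasurable
    simp only [e]
    exact (u.continuous.measurable.comp
      h.measurable_envSeen).stronglyMeasurable.integral_prod_right'.measurable
  forward g hg := by
    obtain ⟨N₀, hN₀⟩ := exists_tsum_eq_exclOp c hg
    refine ⟨N₀, fun N hN t ht => ?_⟩
    have hN' := hN₀ N hN
    have hm2 : ∀ s : ℝ, Measurable fun ω => (η s.toNNReal ω, x s.toNNReal ω) := fun s =>
      h.measurable_pair.comp measurable_prodMk_left
    have hcm : ∀ k, Measurable fun p : Config × ℤ => cutoff g k p.1 p.2 := by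
      intro k
      refine measurable_from_prod_countable_left fun z => ?_
      simp only [cutoff]
      split_ifs
      · exact (g.continuous.comp (trans z).continuous).measurable
      · exact measurable_const
    -- the cutoff is removed by dominated convergence, on both sides of the equation
    have hcut : ∀ s : ℝ, Filter.Tendsto
        (fun k => ∫ ω, cutoff g k (η s.toNNReal ω) (x s.toNNReal ω) ∂P) Filter.atTop
        (𝓝 (mean (envLaw P η x s) g)) := by
      intro s
      rw [h.mean_envLaw]
      refine tendsto_integral_of_dominated_convergence (fun _ => ‖g‖)
        (fun k => ((hcm k).comp (hm2 s)).aestronglyMeasurable) (integrable_const _)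
        (fun k => ae_of_all _ fun ω => ?_) (ae_of_all _ fun ω => ?_)
      · simp only [cutoff]
        split_ifs
        · exact g.abs_le_norm _
        · simp
      · refine tendsto_const_nhds.congr' ?_
        filter_upwards [Filter.eventually_ge_atTop (x s.toNNReal ω).natAbs] with k hk
        rw [cutoff, if_pos hk]
    have hgen : ∀ s : ℝ, Filter.Tendsto (fun k => ∫ ω, generator c (fun z => r z) n (cutoff g k)
        (η s.toNNReal ω) (x s.toNNReal ω) ∂P) Filter.atTop (𝓝 (mean (envLaw P η x s)
          (boxOp ((n : ℝ) ^ 2 • c) ((n : ℝ) • jumpOp r) N g))) := by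
      intro s
      rw [h.mean_envLaw]
      refine tendsto_integral_of_dominated_convergence
        (fun _ => (n : ℝ) ^ 2 * ‖exclOp c N g‖ + n * ∑ z : R, ‖r z‖ * (‖g‖ + ‖g‖))
        (fun k => ((measurable_generator_cutoff c r n g k hN').comp (hm2 s)).aestronglyMeasurable)
        (integrable_const _) (fun k => ae_of_all _ fun ω => ?_) (ae_of_all _ fun ω => ?_)
      · exact abs_generator_cutoff_le c r n g k _ _ hN'
      · exact tendsto_generator_cutoff c r n g _ _ hN'
    have h0 := hcut 0
    rw [Real.toNNReal_zero] at h0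
    have hint : Filter.Tendsto (fun k => ∫ s in (0 : ℝ)..t, ∫ ω, generator c (fun z => r z) n
        (cutoff g k) (η s.toNNReal ω) (x s.toNNReal ω) ∂P) Filter.atTop
        (𝓝 (∫ s in (0 : ℝ)..t, mean (envLaw P η x s)
          (boxOp ((n : ℝ) ^ 2 • c) ((n : ℝ) • jumpOp r) N g))) := by
      refine intervalIntegral.tendsto_integral_filter_of_dominated_convergence
        (fun _ => (n : ℝ) ^ 2 * ‖exclOp c N g‖ + n * ∑ z : R, ‖r z‖ * (‖g‖ + ‖g‖))
        (Filter.Eventually.of_forall fun k => ?_) (Filter.Eventually.of_forall fun k =>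
          ae_of_all _ fun s _ => ?_) intervalIntegrable_const (ae_of_all _ fun s _ => hgen s)
      · exact ((measurable_generator_cutoff c r n g k hN').comp
          h.measurable_pair).stronglyMeasurable.integral_prod_right'.aestronglyMeasurable
      · have h1 := norm_integral_le_of_norm_le_const (μ := P) (f := fun ω => generator c
          (fun z => r z) n (cutoff g k) (η s.toNNReal ω) (x s.toNNReal ω)) (ae_of_all _ fun ω =>
          abs_generator_cutoff_le c r n g k (η s.toNNReal ω) (x s.toNNReal ω) hN')
        rwa [probReal_univ, mul_one] at h1
    refine tendsto_nhds_unique (hcut t) ?_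
    refine (h0.add hint).congr fun k => ?_
    rw [h.integral_cutoff hg k hN' ht]

end Walk

/-! ### Invariance of the Bernoulli measure, and adjoints -/

instance (ρ : unitInterval) : IsProbabilityMeasure (bernoulliProduct ρ) := by
  unfold bernoulliProduct; infer_instance

lemma map_permute_bernoulliProduct (ρ : unitInterval) (σ : Equiv.Perm ℤ) :
    (bernoulliProduct ρ).map (permute σ) = bernoulliProduct ρ := by
  have h := Measure.infinitePi_map_piCongrLeft (X := fun _ : ℤ => Bool)
    (fun _ : ℤ => bernoulliMeasure true false ρ) σ.symm
  have e : (MeasurableEquiv.piCongrLeft (fun _ : ℤ => Bool) σ.symm : Config → Config) =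
      permute σ := by
    funext η z
    have h1 := MeasurableEquiv.piCongrLeft_apply_apply σ.symm (β := fun _ : ℤ => Bool) η (σ z)
    rw [Equiv.symm_apply_apply] at h1
    exact h1
  rw [e] at h
  exact h

lemma mean_permute (ρ : unitInterval) (σ : Equiv.Perm ℤ) (u : Obs) :
    mean (bernoulliProduct ρ) (compOp (permute σ) u) = mean (bernoulliProduct ρ) u := by
  rw [mean_apply, mean_apply]
  conv_rhs => rw [← map_permute_bernoulliProduct ρ σ]
  rw [integral_map (permute σ).continuous.aemeasurable u.continuous.aestronglyMeasurable]
  rfl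

lemma mean_exch (ρ : unitInterval) (y : ℤ) (u : Obs) :
    mean (bernoulliProduct ρ) (compOp (exch y) u) = mean (bernoulliProduct ρ) u :=
  mean_permute ρ _ u

lemma mean_trans (ρ : unitInterval) (x : ℤ) (u : Obs) :
    mean (bernoulliProduct ρ) (compOp (trans x) u) = mean (bernoulliProduct ρ) u :=
  mean_permute ρ _ u

lemma mean_mono {μ : Measure Config} [IsProbabilityMeasure μ] {u v : Obs} (h : ∀ η, u η ≤ v η) :
    mean μ u ≤ mean μ v :=
  integral_mono (u.integrable μ) (v.integrable μ) h

lemma mean_nonneg {μ : Measure Config} [IsProbabilityMeasure μ] {u : Obs} (h : ∀ η, 0 ≤ u η) :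
    0 ≤ mean μ u :=
  integral_nonneg h

/-- The rate of the exchange across a bond does not depend on the values at the bond. -/
lemma rate_trans_exch {c : Obs} (hrev : DependsOn c ({0, 1}ᶜ : Set ℤ)) (y : ℤ) (η : Config) :
    c (trans y (exch y η)) = c (trans y η) := by
  refine hrev fun i hi => ?_
  simp only [Set.mem_compl_iff, Set.mem_insert_iff, Set.mem_singleton_iff, not_or] at hi
  change η (Equiv.swap y (y + 1) (y + i)) = η (y + i)
  rw [Equiv.swap_apply_of_ne_of_ne (by omega) (by omega)]

/-- The Dirichlet form of the exchanges across a bond. -/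
lemma mean_mul_bondOp (ρ : unitInterval) {c : Obs} (hrev : DependsOn c ({0, 1}ᶜ : Set ℤ)) (y : ℤ)
    (u v : Obs) : mean (bernoulliProduct ρ) (v * bondOp c y u) =
      -(1 / 2) * mean (bernoulliProduct ρ) (compOp (trans y) c *
        ((compOp (exch y) u - u) * (compOp (exch y) v - v))) := by
  have h1 := mean_exch ρ y (v * bondOp c y u)
  have e : compOp (exch y) (v * bondOp c y u) + v * bondOp c y u =
      -(compOp (trans y) c * ((compOp (exch y) u - u) * (compOp (exch y) v - v))) := by
    refine Obs.ext fun η => ?_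
    simp only [Obs.add_apply, compOp_apply, Obs.mul_apply, bondOp_apply, Obs.neg_apply,
      Obs.sub_apply, rate_trans_exch hrev, exch_exch]
    ring
  have h2 := congrArg (mean (bernoulliProduct ρ)) e
  rw [map_add, map_neg, h1] at h2
  linarith

lemma mean_mul_exclOp (ρ : unitInterval) {c : Obs} (hrev : DependsOn c ({0, 1}ᶜ : Set ℤ)) (N : ℕ)
    (u v : Obs) : mean (bernoulliProduct ρ) (v * exclOp c N u) =
      -(1 / 2) * ∑ y ∈ Finset.Icc (-N : ℤ) N, mean (bernoulliProduct ρ) (compOp (trans y) c *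
        ((compOp (exch y) u - u) * (compOp (exch y) v - v))) := by
  have e : exclOp c N u = ∑ y ∈ Finset.Icc (-N : ℤ) N, bondOp c y u :=
    Obs.ext fun η => by rw [exclOp_apply, Obs.sum_apply]; rfl
  rw [e, Finset.mul_sum, map_sum, Finset.mul_sum]
  exact Finset.sum_congr rfl fun y _ => mean_mul_bondOp ρ hrev y u v

lemma mean_exclOp_comm (ρ : unitInterval) {c : Obs} (hrev : DependsOn c ({0, 1}ᶜ : Set ℤ)) (N : ℕ)
    (u v : Obs) : mean (bernoulliProduct ρ) (v * exclOp c N u) =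
      mean (bernoulliProduct ρ) (u * exclOp c N v) := by
  rw [mean_mul_exclOp ρ hrev, mean_mul_exclOp ρ hrev]
  congr 1
  refine Finset.sum_congr rfl fun y _ => ?_
  rw [mul_comm (compOp (exch y) u - u)]

/-- The adjoint of `jumpOp r` with respect to the Bernoulli measure. -/
def jumpAdj {R : Finset ℤ} (r : R → Obs) : Obs →L[ℝ] Obs :=
  ∑ z : R, (compOp (trans (-z)) ∘L mulOp (r z) - mulOp (r z))

lemma jumpAdj_eq {R : Finset ℤ} (r : R → Obs) (u : Obs) :
    jumpAdj r u = ∑ z : R, (compOp (trans (-z)) (r z * u) - r z * u) := by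
  simp only [jumpAdj, _root_.sum_apply]
  rfl

lemma jumpOp_eq {R : Finset ℤ} (r : R → Obs) (u : Obs) :
    jumpOp r u = ∑ z : R, r z * (compOp (trans z) u - u) := by
  simp only [jumpOp, _root_.sum_apply]
  rfl

lemma mean_jumpAdj (ρ : unitInterval) {R : Finset ℤ} (r : R → Obs) (u v : Obs) :
    mean (bernoulliProduct ρ) (v * jumpAdj r u) = mean (bernoulliProduct ρ) (u * jumpOp r v) := by
  rw [jumpAdj_eq, jumpOp_eq, Finset.mul_sum, Finset.mul_sum, map_sum, map_sum]
  refine Finset.sum_congr rfl fun z _ => ?_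
  have h1 := mean_trans ρ z (v * compOp (trans (-z)) (r z * u))
  have e : compOp (trans z) (v * compOp (trans (-z)) (r z * u)) =
      compOp (trans z) v * (r z * u) := by
    refine Obs.ext fun η => ?_
    simp only [compOp_apply, Obs.mul_apply, trans_trans, neg_add_cancel, trans_zero]
  rw [e] at h1
  rw [mul_sub, map_sub, ← h1, ← map_sub]
  congr 1
  ring

lemma mean_boxOp_adjoint (ρ : unitInterval) {c : Obs} (hrev : DependsOn c ({0, 1}ᶜ : Set ℤ))
    {R : Finset ℤ} (r : R → Obs) (a : ℝ) (N : ℕ) (u v : Obs) :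
    mean (bernoulliProduct ρ) (v * boxOp c (a • jumpAdj r) N u) =
      mean (bernoulliProduct ρ) (u * boxOp c (a • jumpOp r) N v) := by
  change mean (bernoulliProduct ρ) (v * (exclOp c N u + a • jumpAdj r u)) =
    mean (bernoulliProduct ρ) (u * (exclOp c N v + a • jumpOp r v))
  rw [mul_add, mul_add, map_add, map_add, mean_exclOp_comm ρ hrev, mul_smul_comm, mul_smul_comm,
    map_smul, map_smul, mean_jumpAdj]

/-- Duality for the semigroups, from that of the generators, term by term in the exponential
series. -/
lemma mean_boxSemigroup_adjoint (ρ : unitInterval) {c : Obs}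
    (hrev : DependsOn c ({0, 1}ᶜ : Set ℤ)) {R : Finset ℤ} (r : R → Obs) (a : ℝ) (N : ℕ) (t : ℝ)
    (u v : Obs) :
    mean (bernoulliProduct ρ) (v * boxSemigroup c (a • jumpAdj r) N t u) =
      mean (bernoulliProduct ρ) (u * boxSemigroup c (a • jumpOp r) N t v) := by
  have hpow : ∀ (k : ℕ) (u v : Obs),
      mean (bernoulliProduct ρ) (v * (boxOp c (a • jumpAdj r) N ^ k) u) =
      mean (bernoulliProduct ρ) (u * (boxOp c (a • jumpOp r) N ^ k) v) := by
    intro k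
    induction k with
    | zero =>
      intro u v
      change mean _ (v * u) = mean _ (u * v)
      rw [mul_comm]
    | succ k ih =>
      intro u v
      rw [pow_succ (boxOp c (a • jumpAdj r) N), pow_succ' (boxOp c (a • jumpOp r) N)]
      change mean _ (v * (boxOp c (a • jumpAdj r) N ^ k) (boxOp c (a • jumpAdj r) N u)) =
        mean _ (u * boxOp c (a • jumpOp r) N ((boxOp c (a • jumpOp r) N ^ k) v))
      rw [ih, mul_comm, ← mean_boxOp_adjoint ρ hrev, mul_comm]
  have h1 := ((hasSum_exp_smul_apply (boxOp c (a • jumpAdj r) N) t u).mul_left v).mapL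
    (mean (bernoulliProduct ρ))
  have h2 := ((hasSum_exp_smul_apply (boxOp c (a • jumpOp r) N) t v).mul_left u).mapL
    (mean (bernoulliProduct ρ))
  refine h1.unique (h2.congr_fun fun k => ?_)
  rw [mul_smul_comm, mul_smul_comm, map_smul, map_smul, hpow]

/-! ### Translations of local observables by exchanges -/

/-- The exchanges across a list of bonds, one after the other. -/
def exchList (l : List ℤ) (η : Config) : Config := l.foldl (fun ζ y => exch y ζ) η

lemma exchList_append (l l' : List ℤ) (η : Config) :
    exchList (l ++ l') η = exchList l' (exchList l η) :=
  List.foldl_append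

lemma exchList_cons (y : ℤ) (l : List ℤ) (η : Config) :
    exchList (y :: l) η = exchList l (exch y η) := rfl

lemma exchList_reverse (l : List ℤ) (η : Config) : exchList l (exchList l.reverse η) = η := by
  induction l generalizing η with
  | nil => rfl
  | cons y l ih =>
    rw [List.reverse_cons, exchList_append, exchList_cons]
    change exchList l (exch y (exch y (exchList l.reverse η))) = η
    rw [exch_exch, ih]

/-- Shifting an interval of length `k` by one takes `k` exchanges, which carry along the value at
`a - 1`; nothing to the left of `a - 1` is touched. -/
lemma exists_exchList_shift_one (k : ℕ) : ∀ a : ℤ, ∃ l : List ℤ, ∀ η : Config,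
    (∀ j, a ≤ j → j < a + k → exchList l η j = η (j - 1)) ∧
      ∀ j, j < a - 1 → exchList l η j = η j := by
  induction k with
  | zero =>
    exact fun a => ⟨[], fun η => ⟨fun j h1 h2 => by omega, fun j _ => rfl⟩⟩
  | succ k ih =>
    intro a
    obtain ⟨l, hl⟩ := ih (a + 1)
    refine ⟨l ++ [a - 1], fun η => ?_⟩
    obtain ⟨h1, h2⟩ := hl η
    have e : ∀ j, exchList (l ++ [a - 1]) η j =
        exchList l η (Equiv.swap (a - 1) (a - 1 + 1) j) := by
      intro j
      rw [exchList_append]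
      rfl
    refine ⟨fun j hj1 hj2 => ?_, fun j hj => ?_⟩
    · rw [e]
      rcases eq_or_lt_of_le hj1 with rfl | hj
      · rw [sub_add_cancel, Equiv.swap_apply_right, h2 _ (by omega)]
      · rw [Equiv.swap_apply_of_ne_of_ne (by omega) (by omega), h1 j (by omega) (by
          push_cast at hj2; omega)]
    · rw [e, Equiv.swap_apply_of_ne_of_ne (by omega) (by omega), h2 j (by omega)]

/-- On any given interval, a shift coincides with a product of exchanges. -/
lemma exists_exchList_shift (z a : ℤ) (k : ℕ) : ∃ l : List ℤ, ∀ (η : Config) (j : ℤ),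
    a ≤ j → j < a + k → exchList l η j = η (j + z) := by
  have key : ∀ m : ℕ, ∀ (a : ℤ) (k : ℕ), ∃ l : List ℤ, ∀ (η : Config) (j : ℤ),
      a ≤ j → j < a + k → exchList l η j = η (j - m) := by
    intro m
    induction m with
    | zero => exact fun a k => ⟨[], fun η j _ _ => by simp [exchList]⟩
    | succ m ih =>
      intro a k
      obtain ⟨l1, h1⟩ := ih (a - 1) (k + 1)
      obtain ⟨l2, h2⟩ := exists_exchList_shift_one k a
      refine ⟨l1 ++ l2, fun η j hj1 hj2 => ?_⟩
      rw [exchList_append, (h2 _).1 j hj1 hj2, h1 η (j - 1) (by omega) (by push_cast; omega)]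
      congr 1
      push_cast
      ring
  obtain ⟨m, rfl | rfl⟩ := z.eq_nat_or_neg
  · obtain ⟨l, hl⟩ := key m (a + m) k
    refine ⟨l.reverse, fun η j hj1 hj2 => ?_⟩
    have h := hl (exchList l.reverse η) (j + m) (by omega) (by omega)
    rw [exchList_reverse, add_sub_cancel_right] at h
    exact h.symm
  · exact key m a k

lemma exists_exchList_eq_trans {r : Obs} (hr : IsLocal r) (z : ℤ) :
    ∃ l : List ℤ, ∀ η, r (trans z η) = r (exchList l η) := by
  obtain ⟨A, hA⟩ := hr
  set m := A.sup Int.natAbs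
  have hm : ∀ a ∈ A, a.natAbs ≤ m := fun a ha => Finset.le_sup (f := Int.natAbs) ha
  obtain ⟨l, hl⟩ := exists_exchList_shift z (-m) (2 * m + 1)
  refine ⟨l, fun η => hA fun a ha => ?_⟩
  have := hm a ha
  rw [hl η a (by omega) (by push_cast; omega), add_comm]
  rfl

/-! ### The entropy production -/

/-- The absolute value of an observable. -/
def Obs.abs (u : Obs) : Obs := Obs.mk (fun η => |u η|) u.continuous.abs

/-- Telescoping: along a list of exchanges the expectation changes by the sum of
the changes across the bonds. -/
lemma mean_exchList_sub_le (ρ : unitInterval) (g u : Obs) (l : List ℤ) {G : Obs}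
    (hG : ∀ η, G η = g (exchList l η)) :
    mean (bernoulliProduct ρ) ((G - g) * u) ≤
      ‖g‖ * (l.map fun y => mean (bernoulliProduct ρ) (compOp (exch y) u - u).abs).sum := by
  induction l generalizing G with
  | nil =>
    have : G = g := Obs.ext hG
    simp [this]
  | cons y l ih =>
    have hcont : Continuous fun η => g (exchList l η) := by
      refine g.continuous.comp ?_
      clear ih hG
      induction l with
      | nil => exact continuous_id
      | cons y l ih => exact ih.comp (exch y).continuous
    set F : Obs := Obs.mk _ hcont with hF
    have hGF : G = compOp (exch y) F := Obs.ext hG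
    have h1 := mean_exch ρ y (F * compOp (exch y) u)
    have e : compOp (exch y) (F * compOp (exch y) u) = G * u := by
      refine Obs.ext fun η => ?_
      simp only [hGF, compOp_apply, Obs.mul_apply, exch_exch]
    rw [e] at h1
    have e2 : (G - g) * u = G * u - F * u + (F - g) * u := by ring
    rw [e2, map_add, map_sub, h1, ← map_sub, ← mul_sub, List.map_cons, List.sum_cons, mul_add]
    refine add_le_add ?_ (ih fun η => rfl)
    have h3 : mean (bernoulliProduct ρ) (F * (compOp (exch y) u - u)) ≤
        mean (bernoulliProduct ρ) (‖g‖ • (compOp (exch y) u - u).abs) := by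
      refine mean_mono fun η => ?_
      refine (le_abs_self _).trans ?_
      change |F η * (u (exch y η) - u η)| ≤ ‖g‖ * |u (exch y η) - u η|
      rw [abs_mul]
      exact mul_le_mul_of_nonneg_right (g.abs_le_norm _) (abs_nonneg _)
    rwa [map_smul, smul_eq_mul] at h3

/-- A substitute for `(√b - √a)² ≤ (b - a) (log b - log a)` that needs no square roots. -/
lemma abs_sub_le_mul_log {a b θ : ℝ} (ha : 0 < a) (hb : 0 < b) (hθ : 0 < θ) :
    |b - a| ≤ θ / 2 * ((b - a) * (Real.log b - Real.log a)) + (b + a) / (2 * θ) := by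
  have hlog : ∀ {a b : ℝ}, 0 < a → 0 < b → b - a ≤ b * (Real.log b - Real.log a) := by
    intro a b ha hb
    have h := Real.one_sub_inv_le_log_of_pos (div_pos hb ha)
    rw [Real.log_div hb.ne' ha.ne', inv_div] at h
    have h2 := mul_le_mul_of_nonneg_left h hb.le
    rwa [mul_sub, mul_one, mul_div_cancel₀ _ hb.ne'] at h2
  have hX : 0 ≤ (b - a) * (Real.log b - Real.log a) ∧
      (b - a) ^ 2 ≤ (b + a) * ((b - a) * (Real.log b - Real.log a)) := by
    rcases le_total a b with h | h
    · have h1 := Real.log_le_log ha h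
      have h2 : 0 ≤ (b - a) * (Real.log b - Real.log a) :=
        mul_nonneg (sub_nonneg.2 h) (sub_nonneg.2 h1)
      have h3 := mul_le_mul_of_nonneg_left (hlog ha hb) (sub_nonneg.2 h)
      exact ⟨h2, by nlinarith [mul_nonneg ha.le h2]⟩
    · have h1 := Real.log_le_log hb h
      have h2 : 0 ≤ (b - a) * (Real.log b - Real.log a) :=
        mul_nonneg_of_nonpos_of_nonpos (sub_nonpos.2 h) (sub_nonpos.2 h1)
      have h3 := mul_le_mul_of_nonneg_left (hlog hb ha) (sub_nonneg.2 h)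
      exact ⟨h2, by nlinarith [mul_nonneg hb.le h2]⟩
  obtain ⟨hX0, hX⟩ := hX
  set X := (b - a) * (Real.log b - Real.log a)
  refine abs_le_of_sq_le_sq (hX.trans ?_) (by positivity)
  have e : (θ / 2 * X + (b + a) / (2 * θ)) ^ 2 =
      (b + a) * X + (θ / 2 * X - (b + a) / (2 * θ)) ^ 2 := by
    field_simp
    ring
  rw [e]
  linarith [sq_nonneg (θ / 2 * X - (b + a) / (2 * θ))]

/-- The concavity of the logarithm. -/
lemma mul_log_sub_log_le {a b : ℝ} (ha : 0 < a) (hb : 0 < b) :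
    a * (Real.log b - Real.log a) ≤ b - a := by
  have h := Real.log_le_sub_one_of_pos (div_pos hb ha)
  rw [Real.log_div hb.ne' ha.ne'] at h
  have h2 := mul_le_mul_of_nonneg_left h ha.le
  rwa [mul_sub a (b / a), mul_one, mul_div_cancel₀ _ ha.ne'] at h2

/-- The entropy production across a bond; `v` stands for `log u`. -/
def bondEntropy (ρ : unitInterval) (u v : Obs) (y : ℤ) : ℝ :=
  mean (bernoulliProduct ρ) ((compOp (exch y) u - u) * (compOp (exch y) v - v))

section Entropy

variable {ρ : unitInterval} {u v : Obs}

lemma sub_mul_log_sub_nonneg (hu : ∀ η, 0 < u η) (hv : ∀ η, v η = Real.log (u η)) (η ζ : Config) :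
    0 ≤ (u ζ - u η) * (v ζ - v η) := by
  rw [hv, hv]
  rcases le_total (u η) (u ζ) with h | h
  · exact mul_nonneg (sub_nonneg.2 h) (sub_nonneg.2 (Real.log_le_log (hu _) h))
  · exact mul_nonneg_of_nonpos_of_nonpos (sub_nonpos.2 h)
      (sub_nonpos.2 (Real.log_le_log (hu _) h))

lemma bondEntropy_nonneg (hu : ∀ η, 0 < u η) (hv : ∀ η, v η = Real.log (u η)) (y : ℤ) :
    0 ≤ bondEntropy ρ u v y :=
  mean_nonneg fun η => sub_mul_log_sub_nonneg hu hv η (exch y η)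

lemma mean_abs_exch_sub_le (hu : ∀ η, 0 < u η) (hv : ∀ η, v η = Real.log (u η))
    (hu1 : mean (bernoulliProduct ρ) u = 1) (y : ℤ) {θ : ℝ} (hθ : 0 < θ) :
    mean (bernoulliProduct ρ) (compOp (exch y) u - u).abs ≤
      θ / 2 * bondEntropy ρ u v y + 1 / θ := by
  have h : mean (bernoulliProduct ρ) (compOp (exch y) u - u).abs ≤
      mean (bernoulliProduct ρ) ((θ / 2) • ((compOp (exch y) u - u) * (compOp (exch y) v - v)) +
        (1 / (2 * θ)) • (compOp (exch y) u + u)) := by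
    refine mean_mono fun η => ?_
    have := abs_sub_le_mul_log (hu η) (hu (exch y η)) hθ
    rw [← hv, ← hv] at this
    refine this.trans (le_of_eq ?_)
    simp only [Obs.add_apply, Obs.smul_apply, Obs.mul_apply, Obs.sub_apply, compOp_apply]
    ring
  refine h.trans (le_of_eq ?_)
  rw [map_add, map_smul, map_smul, map_add, mean_exch, hu1, bondEntropy, smul_eq_mul, smul_eq_mul]
  field_simp
  ring

lemma mean_log_mul_exclOp_le (hu : ∀ η, 0 < u η) (hv : ∀ η, v η = Real.log (u η)) {c : Obs}
    (hrev : DependsOn c ({0, 1}ᶜ : Set ℤ)) {ε : ℝ} (hε : ∀ η, ε ≤ c η) (N : ℕ) :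
    mean (bernoulliProduct ρ) (v * exclOp c N u) ≤
      -(ε / 2) * ∑ y ∈ Finset.Icc (-N : ℤ) N, bondEntropy ρ u v y := by
  have h : ε * ∑ y ∈ Finset.Icc (-N : ℤ) N, bondEntropy ρ u v y ≤
      ∑ y ∈ Finset.Icc (-N : ℤ) N, mean (bernoulliProduct ρ) (compOp (trans y) c *
        ((compOp (exch y) u - u) * (compOp (exch y) v - v))) := by
    rw [Finset.mul_sum]
    refine Finset.sum_le_sum fun y _ => ?_
    rw [bondEntropy, ← smul_eq_mul, ← map_smul]
    refine mean_mono fun η => ?_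
    exact mul_le_mul_of_nonneg_right (hε _) (sub_mul_log_sub_nonneg hu hv η (exch y η))
  rw [mean_mul_exclOp ρ hrev]
  linarith

/-- The jumps of the walker change the entropy by a quantity that is linear in the density. -/
lemma mean_log_mul_jumpAdj_le (hu : ∀ η, 0 < u η) (hv : ∀ η, v η = Real.log (u η)) {R : Finset ℤ}
    {r : R → Obs} (hr : ∀ z η, 0 ≤ r z η) :
    mean (bernoulliProduct ρ) (v * jumpAdj r u) ≤
      ∑ z : R, mean (bernoulliProduct ρ) ((compOp (trans (-z)) (r z) - r z) * u) := by
  rw [mean_jumpAdj, jumpOp_eq, Finset.mul_sum, map_sum]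
  refine Finset.sum_le_sum fun z _ => ?_
  have h1 : mean (bernoulliProduct ρ) (u * (r z * (compOp (trans z) v - v))) ≤
      mean (bernoulliProduct ρ) (r z * compOp (trans z) u - r z * u) := by
    refine mean_mono fun η => ?_
    simp only [Obs.mul_apply, Obs.sub_apply, compOp_apply, hv]
    have h2 := mul_le_mul_of_nonneg_left (mul_log_sub_log_le (hu η) (hu (trans z η))) (hr z η)
    linarith
  refine h1.trans (le_of_eq ?_)
  have h3 := mean_trans ρ z (compOp (trans (-z)) (r z) * u)
  have e : compOp (trans z) (compOp (trans (-z)) (r z) * u) = r z * compOp (trans z) u := by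
    refine Obs.ext fun η => ?_
    simp only [compOp_apply, Obs.mul_apply, trans_trans, neg_add_cancel, trans_zero]
  rw [map_sub, sub_mul, map_sub, ← e, h3]

end Entropy

/-- The entropy production is bounded, uniformly in `n`, in the exchange rate, in the box and in
the density: what the jumps of the walker produce in a fixed set of bonds at speed `n` is dominated
by what the exchanges dissipate there at speed `n ^ 2`. -/
theorem exists_mean_log_mul_boxOp_le (ρ : unitInterval) {R : Finset ℤ} {r : R → Obs}
    (hr_local : ∀ z, IsLocal (r z)) (hr : ∀ z η, 0 ≤ r z η) {ε : ℝ} (hε : 0 < ε) :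
    ∃ (C : ℝ) (N₀ : ℕ), ∀ c : Obs, DependsOn c ({0, 1}ᶜ : Set ℤ) → (∀ η, ε ≤ c η) →
      ∀ n : ℕ, 1 ≤ n → ∀ N, N₀ ≤ N → ∀ u v : Obs, (∀ η, 0 < u η) →
        (∀ η, v η = Real.log (u η)) → mean (bernoulliProduct ρ) u = 1 →
        mean (bernoulliProduct ρ) (v * boxOp ((n : ℝ) ^ 2 • c) ((n : ℝ) • jumpAdj r) N u) ≤ C := by
  choose l hl using fun z : R => exists_exchList_eq_trans (hr_local z) (-z)
  set κ : ℝ := ∑ z : R, ‖r z‖ * (l z).length with hκ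
  have hκ0 : 0 ≤ κ := Finset.sum_nonneg fun z _ => by positivity
  refine ⟨κ * (κ + 1) / ε, Finset.univ.sup fun z : R => (l z).toFinset.sup Int.natAbs, ?_⟩
  intro c hrev hc n hn N hN u v hu hv hu1
  have hn0 : (0 : ℝ) < n := by exact_mod_cast hn
  have hmem : ∀ z : R, ∀ y ∈ l z, y ∈ Finset.Icc (-N : ℤ) N := by
    intro z y hy
    have h1 : y.natAbs ≤ (l z).toFinset.sup Int.natAbs :=
      Finset.le_sup (f := Int.natAbs) (List.mem_toFinset.2 hy)
    have h2 : (l z).toFinset.sup Int.natAbs ≤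
        Finset.univ.sup fun z : R => (l z).toFinset.sup Int.natAbs :=
      Finset.le_sup (f := fun z : R => (l z).toFinset.sup Int.natAbs) (Finset.mem_univ z)
    rw [Finset.mem_Icc]
    omega
  set T := ∑ y ∈ Finset.Icc (-N : ℤ) N, bondEntropy ρ u v y with hT
  have hT0 : 0 ≤ T := Finset.sum_nonneg fun y _ => bondEntropy_nonneg hu hv y
  have hyT : ∀ y ∈ Finset.Icc (-N : ℤ) N, bondEntropy ρ u v y ≤ T := fun y hy =>
    Finset.single_le_sum (f := bondEntropy ρ u v) (fun y _ => bondEntropy_nonneg hu hv y) hy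
  -- with this `θ` the multiple `n κ θ / 2` of `T` is at most the dissipation `n² ε / 2`, and the
  -- remainder `n κ / θ` is the constant `κ (κ + 1) / ε`; `κ + 1` avoids a division by zero
  set θ : ℝ := n * ε / (κ + 1) with hθ
  have hθ0 : 0 < θ := by positivity
  have h1 := mean_log_mul_exclOp_le (ρ := ρ) hu hv (c := (n : ℝ) ^ 2 • c) (ε := (n : ℝ) ^ 2 * ε)
    (fun η ζ h => congrArg (fun s => (n : ℝ) ^ 2 * s) (hrev h))
    (fun η => mul_le_mul_of_nonneg_left (hc η) (by positivity)) N
  have h2 : mean (bernoulliProduct ρ) (v * jumpAdj r u) ≤ κ * (θ / 2 * T + 1 / θ) := by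
    refine (mean_log_mul_jumpAdj_le hu hv hr).trans ?_
    rw [hκ, Finset.sum_mul]
    refine Finset.sum_le_sum fun z _ => ?_
    refine (mean_exchList_sub_le ρ (r z) u (l z) (fun η => hl z η)).trans ?_
    rw [mul_assoc]
    refine mul_le_mul_of_nonneg_left ?_ (norm_nonneg _)
    have h3 := List.sum_le_card_nsmul ((l z).map fun y =>
      mean (bernoulliProduct ρ) (compOp (exch y) u - u).abs) (θ / 2 * T + 1 / θ) (by
        intro w hw
        obtain ⟨y, hy, rfl⟩ := List.mem_map.1 hw
        refine (mean_abs_exch_sub_le hu hv hu1 y hθ0).trans ?_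
        have := hyT y (hmem z y hy)
        gcongr)
    rwa [List.length_map, nsmul_eq_mul] at h3
  have e : v * boxOp ((n : ℝ) ^ 2 • c) ((n : ℝ) • jumpAdj r) N u =
      v * exclOp ((n : ℝ) ^ 2 • c) N u + (n : ℝ) • (v * jumpAdj r u) := by
    rw [← mul_smul_comm, ← mul_add]
    rfl
  rw [e, map_add, map_smul, smul_eq_mul]
  have h4 := mul_le_mul_of_nonneg_left h2 hn0.le
  have h5 : (n : ℝ) * (κ * (θ / 2 * T + 1 / θ)) =
      (n : ℝ) ^ 2 * ε / 2 * (κ / (κ + 1)) * T + κ * (κ + 1) / ε := by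
    rw [hθ]
    field_simp
  have h6 : (n : ℝ) ^ 2 * ε / 2 * (κ / (κ + 1)) * T ≤ (n : ℝ) ^ 2 * ε / 2 * T := by
    refine mul_le_mul_of_nonneg_right (mul_le_of_le_one_right (by positivity) ?_) hT0
    rw [div_le_one (by positivity)]
    linarith
  linarith

/-! ### The jump operators on observables of finite `oscNorm` -/

/-- Operators that are bounded with respect to `oscNorm`. -/
def OscBounded (M : Obs →L[ℝ] Obs) : Prop :=
  ∃ m : ℝ, 0 ≤ m ∧ ∀ u, oscNorm (M u) ≤ ENNReal.ofReal m * oscNorm u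

lemma OscBounded.of_ne_top {M : Obs →L[ℝ] Obs} {m : ℝ≥0∞} (hm : m ≠ ⊤)
    (h : ∀ u, oscNorm (M u) ≤ m * oscNorm u) : OscBounded M :=
  ⟨m.toReal, ENNReal.toReal_nonneg, fun u => by rw [ENNReal.ofReal_toReal hm]; exact h u⟩

lemma OscBounded.add {M M' : Obs →L[ℝ] Obs} (h : OscBounded M) (h' : OscBounded M') :
    OscBounded (M + M') := by
  obtain ⟨m, hm, h⟩ := h
  obtain ⟨m', hm', h'⟩ := h'
  refine ⟨m + m', add_nonneg hm hm', fun u => ?_⟩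
  rw [ENNReal.ofReal_add hm hm', add_mul]
  exact (oscNorm_add_le _ _).trans (add_le_add (h u) (h' u))

lemma OscBounded.smul {M : Obs →L[ℝ] Obs} (h : OscBounded M) (a : ℝ) : OscBounded (a • M) := by
  obtain ⟨m, hm, h⟩ := h
  refine ⟨|a| * m, by positivity, fun u => ?_⟩
  rw [ENNReal.ofReal_mul (abs_nonneg a), mul_assoc]
  exact (oscNorm_smul a (M u)).le.trans (mul_le_mul_right (h u) _)

lemma OscBounded.sub {M M' : Obs →L[ℝ] Obs} (h : OscBounded M) (h' : OscBounded M') :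
    OscBounded (M - M') := by
  have e : M - M' = M + (-1 : ℝ) • M' := by
    refine ContinuousLinearMap.ext fun u => Obs.ext fun η => ?_
    change M u η - M' u η = M u η + -1 * M' u η
    ring
  rw [e]
  exact h.add (h'.smul _)

lemma OscBounded.comp {M M' : Obs →L[ℝ] Obs} (h : OscBounded M) (h' : OscBounded M') :
    OscBounded (M ∘L M') := by
  obtain ⟨m, hm, h⟩ := h
  obtain ⟨m', hm', h'⟩ := h'
  refine ⟨m * m', mul_nonneg hm hm', fun u => ?_⟩
  rw [ENNReal.ofReal_mul hm, mul_assoc]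
  exact (h _).trans (mul_le_mul_right (h' u) _)

lemma OscBounded.zero : OscBounded 0 := ⟨0, le_rfl, fun u => by
  change oscNorm 0 ≤ _
  rw [oscNorm_zero]
  exact zero_le⟩

lemma OscBounded.sum {ι : Type*} (s : Finset ι) {M : ι → Obs →L[ℝ] Obs}
    (h : ∀ i, OscBounded (M i)) : OscBounded (∑ i ∈ s, M i) := by
  classical
  induction s using Finset.induction_on with
  | empty => rw [Finset.sum_empty]; exact OscBounded.zero
  | insert i s hi ih => rw [Finset.sum_insert hi]; exact (h i).add ih

lemma OscBounded.one : OscBounded 1 := ⟨1, zero_le_one, fun u => by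
  rw [ENNReal.ofReal_one, one_mul]
  exact le_rfl⟩

lemma oscBounded_mulOp {a : Obs} (ha : IsLocal a) : OscBounded (mulOp a) :=
  OscBounded.of_ne_top (oscNorm_ne_top_of_isLocal ha) (oscNorm_mulOp_le a)

lemma oscBounded_trans (z : ℤ) : OscBounded (compOp (trans z)) :=
  OscBounded.of_ne_top (weight_ne_top z) (oscNorm_trans_le z)

lemma oscBounded_jumpOp {R : Finset ℤ} {r : R → Obs} (hr : ∀ z, IsLocal (r z)) :
    OscBounded (jumpOp r) :=
  OscBounded.sum _ fun z => (oscBounded_mulOp (hr z)).comp ((oscBounded_trans _).sub OscBounded.one)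

lemma oscBounded_jumpAdj {R : Finset ℤ} {r : R → Obs} (hr : ∀ z, IsLocal (r z)) :
    OscBounded (jumpAdj r) :=
  OscBounded.sum _ fun z =>
    ((oscBounded_trans _).comp (oscBounded_mulOp (hr z))).sub (oscBounded_mulOp (hr z))

lemma isLocal_one : IsLocal (1 : Obs) := ⟨∅, fun _ _ _ => rfl⟩

lemma exclOp_one (c : Obs) (N : ℕ) : exclOp c N 1 = 0 :=
  Obs.ext fun η => by simp [exclOp_apply]

lemma jumpOp_one {R : Finset ℤ} (r : R → Obs) : jumpOp r 1 = 0 :=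
  Obs.ext fun η => by simp [jumpOp_apply]

lemma boxOp_jumpOp_one (c : Obs) {R : Finset ℤ} (r : R → Obs) (a : ℝ) (N : ℕ) :
    boxOp c (a • jumpOp r) N 1 = 0 := by
  change exclOp c N 1 + a • jumpOp r 1 = 0
  rw [exclOp_one, jumpOp_one, smul_zero, add_zero]

lemma boxSemigroup_jumpOp_one (c : Obs) {R : Finset ℤ} (r : R → Obs) (a : ℝ) (N : ℕ) (t : ℝ) :
    boxSemigroup c (a • jumpOp r) N t 1 = 1 := by
  have h := is_const_of_deriv_eq_zero
    (f := fun s => boxSemigroup c (a • jumpOp r) N s 1)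
    (fun s => (hasDerivAt_boxSemigroup _ _ _ _ s).differentiableAt)
    (fun s => by
      rw [(hasDerivAt_boxSemigroup _ _ _ _ s).deriv, boxOp_jumpOp_one, map_zero]) t 0
  rwa [boxSemigroup_zero] at h

/-! ### Bounds on the density from below -/

lemma Obs.tendsto_apply {ι : Type*} {l : Filter ι} {u : ι → Obs} {v : Obs}
    (h : Filter.Tendsto u l (𝓝 v)) (η : Config) :
    Filter.Tendsto (fun i => u i η) l (𝓝 (v η)) := by
  rw [tendsto_iff_norm_sub_tendsto_zero] at h ⊢
  exact squeeze_zero (fun _ => norm_nonneg _) (fun i => (u i - v).abs_le_norm η) h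

/-- The exponential series bounds `exp (t B) 1` from below when `B` preserves positivity and
`B 1 ≥ b`. -/
lemma le_exp_smul_apply_one {B : Obs →L[ℝ] Obs} {b : ℝ} (hb : 0 ≤ b)
    (hpos : ∀ u : Obs, (∀ η, 0 ≤ u η) → ∀ η, 0 ≤ B u η) (h1 : ∀ η, b ≤ B 1 η) {t : ℝ} (ht : 0 ≤ t)
    (η : Config) : Real.exp (t * b) ≤ NormedSpace.exp (t • B) 1 η := by
  have hpow : ∀ k : ℕ, ∀ η, b ^ k ≤ (B ^ k) 1 η := by
    intro k
    induction k with
    | zero => intro η; simp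
    | succ k ih =>
      intro η
      have h2 := hpos ((B ^ k) 1 - b ^ k • (1 : Obs)) (fun η => by
        simpa using ih η) η
      rw [map_sub, map_smul, Obs.sub_apply, Obs.smul_apply, sub_nonneg] at h2
      rw [pow_succ, pow_succ' B]
      exact (mul_le_mul_of_nonneg_left (h1 η) (by positivity)).trans h2
  have hs : HasSum (fun k : ℕ => (t * b) ^ k / k.factorial) (Real.exp (t * b)) := by
    rw [Real.exp_eq_exp_ℝ]
    exact NormedSpace.expSeries_div_hasSum_exp (t * b)
  have hs2 : HasSum (fun k : ℕ => t ^ k / k.factorial * (B ^ k) 1 η)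
      (NormedSpace.exp (t • B) 1 η) := by
    have h3 := Obs.tendsto_apply (hasSum_exp_smul_apply B t 1) η
    simp only [Obs.sum_apply, Obs.smul_apply] at h3
    exact h3
  refine hasSum_le (fun k => ?_) hs hs2
  rw [mul_pow, mul_div_right_comm]
  exact mul_le_mul_of_nonneg_left (hpow k η) (by positivity)

/-- Under the adjoint dynamics the density stays above `exp (-κ t)`, with `κ` the largest rate of
the jumps, since only the loss term of the jumps can decrease the minimum. -/
lemma exp_neg_le_boxSemigroup_jumpAdj {c : Obs} (hc : ∀ η, 0 ≤ c η) {R : Finset ℤ} {r : R → Obs}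
    (hr : ∀ z η, 0 ≤ r z η) {a : ℝ} (ha : 0 ≤ a) (N : ℕ) {t : ℝ} (ht : 0 ≤ t) (η : Config) :
    Real.exp (-(t * (a * ∑ z : R, ‖r z‖))) ≤ boxSemigroup c (a • jumpAdj r) N t 1 η := by
  set κ := a * ∑ z : R, ‖r z‖ with hκ
  have hκ0 : 0 ≤ κ := mul_nonneg ha (Finset.sum_nonneg fun _ _ => norm_nonneg _)
  have hK := boxRate_nonneg c N
  set B := boxOp c (a • jumpAdj r) N + (boxRate c N + κ) • (1 : Obs →L[ℝ] Obs) with hB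
  have hloss : ∀ η, a * ∑ z : R, r z η ≤ κ := fun η =>
    mul_le_mul_of_nonneg_left (Finset.sum_le_sum fun z _ => (r z).apply_le_norm η) ha
  have hBu : ∀ u η, B u η = (exclOp c N u + boxRate c N • u) η +
      (a * ∑ z : R, (r z * u) (trans (-z) η) + (κ - a * ∑ z : R, r z η) * u η) := by
    intro u η
    change exclOp c N u η + a * jumpAdj r u η + (boxRate c N + κ) * u η =
      exclOp c N u η + boxRate c N * u η + _
    rw [jumpAdj_eq, Obs.sum_apply]
    simp only [Obs.sub_apply, compOp_apply, Obs.mul_apply, Finset.sum_sub_distrib,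
      ← Finset.sum_mul]
    ring
  have hgain : ∀ u : Obs, (∀ η, 0 ≤ u η) → ∀ η, 0 ≤ a * ∑ z : R, (r z * u) (trans (-z) η) :=
    fun u hu η => mul_nonneg ha (Finset.sum_nonneg fun z _ => mul_nonneg (hr z _) (hu _))
  have hpos : ∀ u : Obs, (∀ η, 0 ≤ u η) → ∀ η, 0 ≤ B u η := by
    intro u hu η
    rw [hBu, exclOp_add_apply]
    refine add_nonneg (add_nonneg (Finset.sum_nonneg fun y _ => mul_nonneg (hc _) (hu _))
      (mul_nonneg (sub_nonneg.2 (sum_rate_le c N η)) (hu _))) (add_nonneg (hgain u hu η)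
      (mul_nonneg (sub_nonneg.2 (hloss η)) (hu η)))
  have h1 : ∀ η, boxRate c N ≤ B 1 η := by
    intro η
    rw [hBu, exclOp_one]
    have h2 := hgain 1 (fun _ => zero_le_one) η
    have h3 := hloss η
    simp only [Obs.add_apply, Obs.zero_apply, Obs.smul_apply, Obs.one_apply]
    linarith
  rw [boxSemigroup, exp_smul_eq_exp_smul_add _ _ (boxRate c N + κ)]
  change _ ≤ Real.exp (-(t * (boxRate c N + κ))) * NormedSpace.exp (t • B) 1 η
  calc _ = Real.exp (-(t * (boxRate c N + κ))) * Real.exp (t * boxRate c N) := by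
        rw [← Real.exp_add]
        congr 1
        ring
    _ ≤ _ := mul_le_mul_of_nonneg_left (le_exp_smul_apply_one hK hpos h1 ht η) (Real.exp_nonneg _)

/-! ### Relative entropy of a measure with a continuous density -/

/-- The logarithm of a positive observable. -/
def Obs.log (u : Obs) (hu : ∀ η, 0 < u η) : Obs :=
  Obs.mk (fun η => Real.log (u η)) (u.continuous.log fun η => (hu η).ne')

lemma Obs.tendsto_log {u : ℕ → Obs} {v : Obs} {δ : ℝ} (hδ : 0 < δ) (hu : ∀ i η, δ ≤ u i η)
    (hv : ∀ η, δ ≤ v η) (h : Filter.Tendsto u Filter.atTop (𝓝 v)) :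
    Filter.Tendsto (fun i => (u i).log fun η => hδ.trans_le (hu i η)) Filter.atTop
      (𝓝 (v.log fun η => hδ.trans_le (hv η))) := by
  rw [tendsto_iff_norm_sub_tendsto_zero] at h ⊢
  refine squeeze_zero (fun _ => norm_nonneg _) (fun i => ?_) (by simpa using h.div_const δ)
  refine (Obs.norm_le (by positivity)).2 fun η => ?_
  change |Real.log (u i η) - Real.log (v η)| ≤ _
  have key : ∀ {a b : ℝ}, δ ≤ a → δ ≤ b → Real.log b - Real.log a ≤ |b - a| / δ := by
    intro a b ha hb
    have ha0 := hδ.trans_le ha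
    have h1 := mul_log_sub_log_le ha0 (hδ.trans_le hb)
    rw [le_div_iff₀ hδ]
    rcases le_or_gt 0 (Real.log b - Real.log a) with h2 | h2
    · calc _ ≤ (Real.log b - Real.log a) * a := mul_le_mul_of_nonneg_left ha h2
        _ ≤ b - a := by rwa [mul_comm]
        _ ≤ _ := le_abs_self _
    · exact (mul_nonpos_of_nonpos_of_nonneg h2.le hδ.le).trans (abs_nonneg _)
  refine (abs_le'.2 ⟨key (hv η) (hu i η), ?_⟩).trans
    (div_le_div_of_nonneg_right ((u i - v).abs_le_norm η) hδ.le)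
  rw [neg_sub]
  refine (key (hu i η) (hv η)).trans (le_of_eq ?_)
  rw [abs_sub_comm]

/-- The functional `u ↦ ∫ u log u`. -/
def entropyFunctional (μ : Measure Config) (u : Obs) : ℝ := ∫ η, u η * Real.log (u η) ∂μ

lemma entropyFunctional_eq {μ : Measure Config} [IsProbabilityMeasure μ] {u : Obs}
    (hu : ∀ η, 0 < u η) : entropyFunctional μ u = mean μ (u * u.log hu) := rfl

/-- The derivative of `u ↦ ∫ u log u` at a function bounded from below by `δ`; the remainder is at
most `‖v - u‖² / δ`, since the second derivative of `a ↦ a log a` is `1 / a`. -/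
lemma hasFDerivAt_entropyFunctional (μ : Measure Config) [IsProbabilityMeasure μ] {u : Obs} {δ : ℝ}
    (hδ : 0 < δ) (hu : ∀ η, δ ≤ u η) :
    HasFDerivAt (entropyFunctional μ)
      (mean μ ∘L mulOp (u.log (fun η => hδ.trans_le (hu η)) + 1)) u := by
  set L := mean μ ∘L mulOp (u.log (fun η => hδ.trans_le (hu η)) + 1) with hL
  have hO : (fun v => entropyFunctional μ v - entropyFunctional μ u - L (v - u)) =O[𝓝 u]
      fun v => ‖v - u‖ ^ 2 := by
    refine Asymptotics.IsBigO.of_bound (1 / δ) ?_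
    filter_upwards [Metric.ball_mem_nhds u hδ] with v hv
    rw [Metric.mem_ball, dist_eq_norm] at hv
    have hv0 : ∀ η, 0 < v η := by
      intro η
      have h1 := neg_abs_le ((v - u) η)
      have h2 := (v - u).abs_le_norm η
      have h3 := hu η
      rw [Obs.sub_apply] at h1 h2
      linarith
    have hu0 : ∀ η, 0 < u η := fun η => hδ.trans_le (hu η)
    have e : entropyFunctional μ v - entropyFunctional μ u - L (v - u) =
        mean μ (v * v.log hv0 - u * u.log hu0 - (u.log hu0 + 1) * (v - u)) := by
      have hLv : L (v - u) = mean μ ((u.log hu0 + 1) * (v - u)) := rfl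
      rw [hLv, entropyFunctional_eq hv0, entropyFunctional_eq hu0, map_sub (mean μ),
        map_sub (mean μ)]
    rw [e, Real.norm_eq_abs, Real.norm_eq_abs, abs_of_nonneg (sq_nonneg ‖v - u‖)]
    refine (abs_mean_le _ _).trans ((Obs.norm_le (by positivity)).2 fun η => ?_)
    change |v η * Real.log (v η) - u η * Real.log (u η) - (Real.log (u η) + 1) * (v η - u η)| ≤ _
    have h1 := mul_log_sub_log_le (hv0 η) (hu0 η)
    have h2 := mul_le_mul_of_nonneg_left (mul_log_sub_log_le (hu0 η) (hv0 η))
      (div_nonneg (hv0 η).le (hu0 η).le)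
    rw [← mul_assoc, div_mul_cancel₀ _ (hu0 η).ne'] at h2
    have h3 : v η / u η * (v η - u η) = (v η - u η) + (v η - u η) ^ 2 / u η := by
      field_simp [(hu0 η).ne']
      ring
    have h4 : (v η - u η) ^ 2 / u η ≤ 1 / δ * ‖v - u‖ ^ 2 := by
      rw [one_div, inv_mul_eq_div]
      refine div_le_div₀ (by positivity) ?_ hδ (hu η)
      rw [← sq_abs]
      exact pow_le_pow_left₀ (abs_nonneg _) ((v - u).abs_le_norm η) 2
    rw [abs_le]
    have h5 : 0 ≤ 1 / δ * ‖v - u‖ ^ 2 := by positivity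
    constructor <;> nlinarith
  have h2 := (Asymptotics.IsBigO.hasFDerivAt (n := 2) hO one_lt_two).add
    (L.hasFDerivAt.comp u ((hasFDerivAt_id u).sub_const u))
  have h3 := h2.add_const (entropyFunctional μ u)
  refine (h3.congr_fderiv ?_).congr_of_eventuallyEq (Filter.Eventually.of_forall fun v => ?_)
  · ext w
    simp
  · simp

/-- A measure is determined by the expectations of local observables, as the cylinder sets
generate the product σ-algebra. -/
lemma withDensity_eq_of_mean {μ ν : Measure Config} [IsProbabilityMeasure μ]
    [IsProbabilityMeasure ν] {f : Obs} (hf : ∀ η, 0 ≤ f η)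
    (h : ∀ u : Obs, IsLocal u → mean μ u = mean ν (u * f)) :
    μ = ν.withDensity fun η => ENNReal.ofReal (f η) := by
  have hset : ∀ s ∈ measurableCylinders fun _ : ℤ => Bool,
      μ s = (ν.withDensity fun η => ENNReal.ofReal (f η)) s := by
    intro s hs
    have hsm : MeasurableSet s := MeasurableSet.of_mem_measurableCylinders hs
    obtain ⟨A, T, hT, rfl⟩ := (mem_measurableCylinders s).1 hs
    have hloc : IsLocal ((cylinder A T).indicator fun _ => (1 : ℝ)) := by
      refine ⟨A, fun η ζ hηζ => ?_⟩
      have : η ∈ cylinder A T ↔ ζ ∈ cylinder A T := by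
        rw [mem_cylinder, mem_cylinder]
        have e : A.restrict η = A.restrict ζ := funext fun i => hηζ i i.2
        rw [e]
      by_cases hη : η ∈ cylinder A T
      · rw [Set.indicator_of_mem hη, Set.indicator_of_mem (this.1 hη)]
      · rw [Set.indicator_of_notMem hη, Set.indicator_of_notMem (mt this.2 hη)]
    have h1 := h (Obs.mk _ hloc.continuous) hloc
    have h2 : mean μ (Obs.mk _ hloc.continuous) = μ.real (cylinder A T) := by
      rw [mean_apply]
      exact integral_indicator_one hsm
    have h3 : mean ν (Obs.mk _ hloc.continuous * f) = ∫ η in cylinder A T, f η ∂ν := by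
      rw [mean_apply, ← integral_indicator hsm]
      refine integral_congr_ae (ae_of_all _ fun η => ?_)
      change (cylinder A T).indicator (fun _ => (1 : ℝ)) η * f η = (cylinder A T).indicator f η
      by_cases hη : η ∈ cylinder A T
      · rw [Set.indicator_of_mem hη, Set.indicator_of_mem hη, one_mul]
      · rw [Set.indicator_of_notMem hη, Set.indicator_of_notMem hη, zero_mul]
    rw [withDensity_apply _ hsm, ← ofReal_integral_eq_lintegral_ofReal
      ((f.integrable ν).restrict) (ae_of_all _ hf), ← h3, ← h1, h2, ofReal_measureReal]
  refine ext_of_generate_finite _ generateFrom_measurableCylinders.symm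
    isPiSystem_measurableCylinders hset ?_
  exact hset _ (univ_mem_measurableCylinders _)

lemma klDiv_withDensity {μ ν : Measure Config} [IsProbabilityMeasure μ] [IsProbabilityMeasure ν]
    {f : Obs} (hf : ∀ η, 0 < f η) (hμ : μ = ν.withDensity fun η => ENNReal.ofReal (f η)) :
    klDiv μ ν ≠ ⊤ ∧ (klDiv μ ν).toReal = entropyFunctional ν f := by
  have hfm : Measurable fun η => ENNReal.ofReal (f η) := f.continuous.measurable.ennreal_ofReal
  have hac : μ ≪ ν := by rw [hμ]; exact withDensity_absolutelyContinuous _ _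
  have hrn : μ.rnDeriv ν =ᵐ[ν] fun η => ENNReal.ofReal (f η) := by
    rw [hμ]; exact Measure.rnDeriv_withDensity ν hfm
  have hllr : llr μ ν =ᵐ[μ] f.log hf := by
    filter_upwards [hac.ae_le hrn] with η hη
    rw [llr, hη, ENNReal.toReal_ofReal (hf η).le]
    rfl
  refine ⟨klDiv_ne_top hac (((f.log hf).integrable μ).congr hllr.symm), ?_⟩
  rw [toReal_klDiv_of_measure_eq hac (by simp), integral_congr_ae hllr, hμ,
    integral_withDensity_eq_integral_toReal_smul hfm (ae_of_all _ fun η => ENNReal.ofReal_lt_top)]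
  refine integral_congr_ae (ae_of_all _ fun η => ?_)
  simp only [ENNReal.toReal_ofReal (hf η).le, smul_eq_mul]
  rfl

/-! ### The entropy of the environment seen by the walker -/

section Density

variable {ρ : unitInterval} {c : Obs} {R : Finset ℤ} {r : R → Obs} {n : ℕ}

/-- The dynamics adjoint to that of the environment seen by the walker, started from the constant
density `1`, has a limit as the boxes grow. It is continuously differentiable in time, it is
bounded from below, and it is the density of any solution of the forward equation that starts from
the Bernoulli measure. -/
theorem exists_density (hc_local : IsLocal c) (hc : ∀ η, 0 ≤ c η)
    (hrev : DependsOn c ({0, 1}ᶜ : Set ℤ)) (hr_local : ∀ z, IsLocal (r z))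
    (hr : ∀ z η, 0 ≤ r z η) (μ : ℝ → Measure Config) [∀ t, IsProbabilityMeasure (μ t)]
    (hμ : SolvesForward ((n : ℝ) ^ 2 • c) ((n : ℝ) • jumpOp r) μ)
    (hμ0 : μ 0 = bernoulliProduct ρ) :
    ∃ f g : ℝ → Obs, f 0 = 1 ∧
      ∀ t, 0 ≤ t → HasDerivWithinAt f (g t) (Set.Ici 0) t ∧ ∃ δ, 0 < δ ∧ (∀ η, δ ≤ f t η) ∧
        (μ t = (bernoulliProduct ρ).withDensity fun η => ENNReal.ofReal (f t η)) ∧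
        ∃ F : ℕ → Obs, (∀ N η, δ ≤ F N η) ∧ (∀ N, mean (bernoulliProduct ρ) (F N) = 1) ∧
          Filter.Tendsto F Filter.atTop (𝓝 (f t)) ∧
          Filter.Tendsto (fun N => boxOp ((n : ℝ) ^ 2 • c) ((n : ℝ) • jumpAdj r) N (F N))
            Filter.atTop (𝓝 (g t)) := by
  set c' := (n : ℝ) ^ 2 • c with hc'
  have hc'0 : ∀ η, 0 ≤ c' η := fun η => mul_nonneg (by positivity) (hc η)
  have hrev' : DependsOn c' ({0, 1}ᶜ : Set ℤ) :=
    fun η ζ h => congrArg (fun s => (n : ℝ) ^ 2 * s) (hrev h)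
  obtain ⟨A, hA⟩ := hc_local
  have hA' : DependsOn c' (A : Set ℤ) :=
    fun η ζ h => congrArg (fun s => (n : ℝ) ^ 2 * s) (hA h)
  obtain ⟨m, hm, hM⟩ := (oscBounded_jumpOp hr_local).smul (n : ℝ)
  obtain ⟨m', hm', hM'⟩ := (oscBounded_jumpAdj hr_local).smul (n : ℝ)
  have h1 : ∀ N, boxOp c' ((n : ℝ) • jumpAdj r) N 1 = ((n : ℝ) • jumpAdj r) 1 := by
    intro N
    change exclOp c' N 1 + ((n : ℝ) • jumpAdj r) 1 = _
    rw [exclOp_one, zero_add]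
  have hone : oscNorm (1 : Obs) ≠ ⊤ := oscNorm_ne_top_of_isLocal isLocal_one
  obtain ⟨f, g, hf, hg, hfg⟩ := exists_limit_hasDerivWithinAt hc'0 hA' hm' hM' h1
    (ne_top_of_le_ne_top (ENNReal.mul_ne_top ENNReal.ofReal_ne_top hone) (hM' 1))
  have hf0 : f 0 = 1 := by
    refine tendsto_nhds_unique (hf 0 le_rfl) ?_
    simp only [boxSemigroup_zero]
    exact tendsto_const_nhds
  refine ⟨f, g, hf0, fun t ht => ⟨hfg t ht, Real.exp (-(t * (n * ∑ z : R, ‖r z‖))),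
    Real.exp_pos _, ?_⟩⟩
  have hlow := fun N η => exp_neg_le_boxSemigroup_jumpAdj hc'0 hr (Nat.cast_nonneg n) N ht η
  have hlowf : ∀ η, Real.exp (-(t * (n * ∑ z : R, ‖r z‖))) ≤ f t η := fun η =>
    ge_of_tendsto' (Obs.tendsto_apply (hf t ht) η) fun N => hlow N η
  refine ⟨hlowf, ?_, fun N => boxSemigroup c' ((n : ℝ) • jumpAdj r) N t 1, hlow, ?_, hf t ht, ?_⟩
  · refine withDensity_eq_of_mean (fun η => (Real.exp_pos _).le.trans (hlowf η)) fun u hu => ?_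
    have h2 := hμ.tendsto_mean hc'0 hA' hm hM (oscNorm_ne_top_of_isLocal hu) ht
    refine tendsto_nhds_unique h2 ?_
    have h3 : Filter.Tendsto (fun N => mean (bernoulliProduct ρ)
        (u * boxSemigroup c' ((n : ℝ) • jumpAdj r) N t 1)) Filter.atTop
        (𝓝 (mean (bernoulliProduct ρ) (u * f t))) :=
      ((mean (bernoulliProduct ρ)).continuous.tendsto _).comp ((hf t ht).const_mul u)
    refine h3.congr fun N => ?_
    rw [mean_boxSemigroup_adjoint ρ hrev', one_mul, mean_apply, mean_apply, hμ0]
  · intro N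
    have h2 := mean_boxSemigroup_adjoint ρ hrev' r n N t 1 1
    rw [one_mul, one_mul, boxSemigroup_jumpOp_one] at h2
    rw [h2, mean_apply]
    simp
  · refine (hg t ht).congr fun N => ?_
    rw [← h1 N, boxSemigroup_comm]

/-- The relative entropy of a solution of the forward equation that starts from the Bernoulli
measure is finite, it vanishes at time `0`, and its derivative inherits any bound that holds for the
entropy production in large boxes. -/
theorem entropy_of_solvesForward (hc_local : IsLocal c) (hc : ∀ η, 0 ≤ c η)
    (hrev : DependsOn c ({0, 1}ᶜ : Set ℤ)) (hr_local : ∀ z, IsLocal (r z))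
    (hr : ∀ z η, 0 ≤ r z η) (μ : ℝ → Measure Config) [∀ t, IsProbabilityMeasure (μ t)]
    (hμ : SolvesForward ((n : ℝ) ^ 2 • c) ((n : ℝ) • jumpOp r) μ)
    (hμ0 : μ 0 = bernoulliProduct ρ) {C : ℝ} {N₀ : ℕ}
    (hC : ∀ N, N₀ ≤ N → ∀ u v : Obs, (∀ η, 0 < u η) →
        (∀ η, v η = Real.log (u η)) → mean (bernoulliProduct ρ) u = 1 →
        mean (bernoulliProduct ρ) (v * boxOp ((n : ℝ) ^ 2 • c) ((n : ℝ) • jumpAdj r) N u) ≤ C) :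
    (∀ t, 0 ≤ t → klDiv (μ t) (bernoulliProduct ρ) ≠ ⊤) ∧
    (klDiv (μ 0) (bernoulliProduct ρ)).toReal = 0 ∧
    ∀ t, 0 ≤ t → ∃ H' : ℝ, HasDerivWithinAt
      (fun s => (klDiv (μ s) (bernoulliProduct ρ)).toReal) H' (Set.Ici 0) t ∧ H' ≤ C := by
  obtain ⟨f, g, hf0, hfg⟩ := exists_density hc_local hc hrev hr_local hr μ hμ hμ0
  have hkl : ∀ t, 0 ≤ t → klDiv (μ t) (bernoulliProduct ρ) ≠ ⊤ ∧
      (klDiv (μ t) (bernoulliProduct ρ)).toReal =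
        entropyFunctional (bernoulliProduct ρ) (f t) := by
    intro t ht
    obtain ⟨-, δ, hδ, hlow, hdens, -⟩ := hfg t ht
    exact klDiv_withDensity (fun η => hδ.trans_le (hlow η)) hdens
  refine ⟨fun t ht => (hkl t ht).1, by rw [hμ0, klDiv_self]; rfl, fun t ht => ?_⟩
  obtain ⟨hder, δ, hδ, hlow, -, F, hFlow, hF1, hFf, hFg⟩ := hfg t ht
  have hd := (hasFDerivAt_entropyFunctional (bernoulliProduct ρ) hδ hlow).comp_hasDerivWithinAt
    t hder
  refine ⟨_, hd.congr (fun s hs => (hkl s hs).2) (hkl t ht).2, ?_⟩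
  change mean (bernoulliProduct ρ) ((Obs.log (f t) (fun η => hδ.trans_le (hlow η)) + 1) * g t) ≤ C
  have hlim := ((mean (bernoulliProduct ρ)).continuous.tendsto _).comp
    (((Obs.tendsto_log hδ hFlow hlow hFf).add_const 1).mul hFg)
  refine le_of_tendsto hlim ?_
  filter_upwards [Filter.eventually_ge_atTop N₀] with N hN
  have hpos : ∀ η, 0 < F N η := fun η => hδ.trans_le (hFlow N η)
  -- the total mass is conserved, so that the `1` in the derivative of `a log a` contributes nothing
  have h0 : mean (bernoulliProduct ρ)
      (1 * boxOp ((n : ℝ) ^ 2 • c) ((n : ℝ) • jumpAdj r) N (F N)) = 0 := by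
    rw [mean_boxOp_adjoint ρ (fun η ζ h => congrArg (fun s => (n : ℝ) ^ 2 * s) (hrev h)),
      boxOp_jumpOp_one, mul_zero, map_zero]
  change mean (bernoulliProduct ρ) (((F N).log hpos + 1) * _) ≤ C
  rw [add_mul, map_add, h0, add_zero]
  exact hC N hN (F N) _ hpos (fun η => rfl) (hF1 N)

end Density

end ExclusionRW

end

theorem mainTheorem3 (ρ : unitInterval) (hρ0 : 0 < ρ) (hρ1 : ρ < 1)
    (R : Finset ℤ) (hR : (0 : ℤ) ∉ R)
    (r : R → ExclusionRW.Config → ℝ)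
    (hr_local : ∀ z, ExclusionRW.IsLocal (r z)) (hr_nonneg : ∀ z η, 0 ≤ r z η)
    (ε₀ : ℝ) (hε₀ : 0 < ε₀) :
    ∃ C : ℝ, ∀ (c : ExclusionRW.Config → ℝ), ExclusionRW.IsInteractionRate ε₀ c →
      ∀ n : ℕ, 1 ≤ n →
      ∀ (S : Type*) [MeasurableSpace S] (P : Measure S) [IsProbabilityMeasure P]
        (𝓕 : Filtration ℝ≥0 ‹MeasurableSpace S›)
        (η : ℝ≥0 → S → ExclusionRW.Config) (x : ℝ≥0 → S → ℤ),
        ExclusionRW.IsWalkInExclusion ρ c r n P 𝓕 η x →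
        (∀ t : ℝ≥0, ExclusionRW.envEntropy ρ P η x t ≠ ⊤) ∧
        (∀ t : ℝ, 0 ≤ t → ∃ H' : ℝ,
          HasDerivWithinAt (fun s : ℝ => (ExclusionRW.envEntropy ρ P η x s.toNNReal).toReal)
            H' (Set.Ici 0) t ∧ H' ≤ C) ∧
        (∀ t : ℝ≥0, (ExclusionRW.envEntropy ρ P η x t).toReal ≤ C * t) := by
  -- the local rates are turned into observables, without changing them as functions
  let r' : R → ExclusionRW.Obs := fun z => ExclusionRW.Obs.mk (r z) (hr_local z).continuous
  obtain ⟨C, N₀, hC⟩ := ExclusionRW.exists_mean_log_mul_boxOp_le ρ (r := r') hr_local hr_nonneg hε₀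
  refine ⟨C, fun c hc n hn S _ P _ 𝓕 η x h => ?_⟩
  let c' : ExclusionRW.Obs := ExclusionRW.Obs.mk c hc.finite_range.continuous
  have h' : ExclusionRW.IsWalkInExclusion ρ c' (fun z => r' z) n P 𝓕 η x := h
  have := h'.isProbabilityMeasure_envLaw
  obtain ⟨hfin, hzero, hder⟩ := ExclusionRW.entropy_of_solvesForward (c := c') (r := r') (n := n)
    hc.finite_range (fun η => hε₀.le.trans (hc.elliptic η)) hc.reversible hr_local hr_nonneg
    (ExclusionRW.envLaw P η x) h'.solvesForward h'.envLaw_zero (C := C) (N₀ := N₀)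
    (fun N hN u v => hC c' hc.reversible hc.elliptic n hn N hN u v)
  refine ⟨fun t => ?_, hder, fun t => ?_⟩
  · have ht := hfin t t.2
    rwa [ExclusionRW.envLaw, Real.toNNReal_coe] at ht
  · -- the bound on the derivative is integrated from time `0`, where the entropy vanishes
    choose! H' hH' hH'C using hder
    have hle := image_le_of_deriv_right_le_deriv_boundary (a := 0) (b := t)
      (f := fun s => (klDiv (ExclusionRW.envLaw P η x s) (ExclusionRW.bernoulliProduct ρ)).toReal)
      (f' := H') (B := fun s => C * s) (B' := fun _ => C)
      (fun s hs => (hH' s hs.1).continuousWithinAt.mono fun _ hy => hy.1)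
      (fun s hs => (hH' s hs.1).mono (Set.Ici_subset_Ici.2 hs.1))
      (by rw [mul_zero]; exact hzero.le) (by fun_prop)
      (fun s _ => by simpa using ((hasDerivAt_id s).const_mul C).hasDerivWithinAt)
      (fun s hs => hH'C s hs.1) (x := t) ⟨t.2, le_rfl⟩
    simp only [ExclusionRW.envLaw, Real.toNNReal_coe] at hle
    exact hle
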